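/- Let $\sigma>1$ and let $\Omega\subset\mathbb R^m$ be open. Consider nets $(f_\varepsilon)_{\varepsilon\in]0,1]}$ of complex valued functions in $C^\infty(\Omega)$. Such a net is * *moderate* if for every compact $K\subset\Omega$ and every $\alpha\in\mathbb Z_+^m$ there are $k>0$, $c>0$, $\varepsilon_0\in]0,1]$ with $\sup_K|\partial^\alpha f_\varepsilon|\le c\exp(k\varepsilon^{-1/(2\sigma-1)})$ for all $\varepsilon\le\varepsilon_0$; * *null* if for every compact $K\subset\Omega$, every $\alpha\in\mathbb Z_+^m$ and every $k>0$ there are $c>0$, $\varepsilon_0\in]0,1]$ with $\sup_K|\partial^\alpha f_\varepsilon|\le c\exp(-k\varepsilon^{-1/(2\sigma-1)})$ for all $\varepsilon\le\varepsilon_0$; * *regular* if for every compact $K\subset\Omega$ there are $k>0$, $c>0$, $\varepsilon_0\in]0,1]$ with $\sup_K|\partial^\alpha f_\varepsilon|\le c^{|\alpha|+1}(\alpha!)^\sigma\exp(k\varepsilon^{-1/(2\sigma-1)})$ for all $\alpha\in\mathbb Z_+^m$ and all $\varepsilon\le\varepsilon_0$. Let $\mathcal G^\sigma(\Omega)$ be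 the differential algebra of moderate nets modulo null nets, and let $\mathcal G^{\sigma,\infty}(\Omega)\subset\mathcal G^\sigma(\Omega)$ be the set of classes of regular nets. Let $D^\sigma(\Omega)$ be the space of compactly supported $\phi\in C^\infty(\Omega)$ such that for every compact $K\subset\Omega$ there is $c>0$ with $\sup_K|\partial^\alpha\phi|\le c^{|\alpha|+1}(\alpha!)^\sigma$ for all $\alpha$. For a compactly supported $u\in\mathcal G^\sigma(\Omega)$, let $\Sigma_g^\sigma(u)\subset\mathbb R^m\setminus\{0\}$ be the complement of the set of $\xi_0\ne0$ having an open conic neighbourhood $\Gamma$ for which there are a representative $(u_\varepsilon)_\varepsilon$ of $u$, with all supports in a fixed compact subset of $\Omega$, and constants $k_1,k_2,c>0$, $\varepsilon_0\in]0,1]$ such that $$|\mathcal F(u_\varepsilon)(\xi)|\le c\exp\left(k_1\varepsilon^{-1/(2\sigma-1)}-k_2|\xi|^{1/\sigma}\right)\quad\text{for all }\xi\in\Gamma,\ \varepsilon\le\varepsilon_0 ,$$ where $\mathcal F(v)(\xi)=\int e^{-ix\xi}v(x)\,dx$. For $f\in\mathcal G^\sigma(\Omega)$, the generalized Gevrey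 wave front $WF_g^\sigma(f)\subset\Omega\times(\mathbb R^m\setminus\{0\})$ is the set of $(x_0,\xi_0)$ such that $\xi_0\in\Sigma_g^\sigma(\phi f)$ for every $\phi\in D^\sigma(\Omega)$ with $\phi\equiv1$ on a neighbourhood of $x_0$. **Corollary.** Let $P(x,D)=\sum_{|\alpha|\le N}a_\alpha(x)D^\alpha$, $D^\alpha=(-i)^{|\alpha|}\partial^\alpha$, be a linear partial differential operator of finite order with coefficients $a_\alpha\in\mathcal G^{\sigma,\infty}(\Omega)$. Then $$WF_g^\sigma(P(x,D)f)\subset WF_g^\sigma(f)\qquad\text{for all }f\in\mathcal G^\sigma(\Omega).$$ -/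

import Mathlib

open Set Filter Topology TopologicalSpace
open scoped ContDiff

noncomputable section

namespace GenGevrey

/-! ## The algebra of smooth functions on an open set, and its partial derivatives -/

/-- Extension by zero of a function on the open set `Ω` to the whole space. -/
def zeroExt {m : ℕ} {Ω : Opens (EuclideanSpace ℝ (Fin m))} (f : Ω → ℂ) :
    EuclideanSpace ℝ (Fin m) → ℂ :=
  Function.extend Subtype.val f 0

section Smooth

variable {m : ℕ} {Ω : Opens (EuclideanSpace ℝ (Fin m))}

theorem zeroExt_coe (f : Ω → ℂ) (x : Ω) : zeroExt f (x : EuclideanSpace ℝ (Fin m)) = f x :=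
  Subtype.val_injective.extend_apply f 0 x

theorem zeroExt_of_mem (f : Ω → ℂ) {x : EuclideanSpace ℝ (Fin m)} (hx : x ∈ Ω) :
    zeroExt f x = f ⟨x, hx⟩ :=
  zeroExt_coe f ⟨x, hx⟩

end Smooth

/-- The algebra `C^∞(Ω)` of complex valued smooth functions on the open set `Ω ⊆ ℝ^m`. -/
def SmoothFun {m : ℕ} (Ω : Opens (EuclideanSpace ℝ (Fin m))) : Subalgebra ℂ (Ω → ℂ) where
  carrier := {f | ContDiffOn ℝ ∞ (zeroExt f) (Ω : Set (EuclideanSpace ℝ (Fin m)))}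
  mul_mem' {f g} hf hg := by
    refine (ContDiffOn.mul hf hg).congr fun x hx => ?_
    simp only [zeroExt_of_mem _ (SetLike.mem_coe.1 hx), Pi.mul_apply]
  add_mem' {f g} hf hg := by
    refine (ContDiffOn.add hf hg).congr fun x hx => ?_
    simp only [zeroExt_of_mem _ (SetLike.mem_coe.1 hx), Pi.add_apply]
  algebraMap_mem' c := by
    refine (contDiffOn_const (c := c)).congr fun x hx => ?_
    rw [zeroExt_of_mem _ (SetLike.mem_coe.1 hx)]
    rfl

section Smooth

variable {m : ℕ} {Ω : Opens (EuclideanSpace ℝ (Fin m))}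

theorem smooth_contDiffAt (f : SmoothFun Ω) (x : Ω) :
    ContDiffAt ℝ ∞ (zeroExt (f : Ω → ℂ)) (x : EuclideanSpace ℝ (Fin m)) :=
  ContDiffOn.contDiffAt f.2 (Ω.isOpen.mem_nhds x.2)

theorem smooth_differentiableAt (f : SmoothFun Ω) (x : Ω) :
    DifferentiableAt ℝ (zeroExt (f : Ω → ℂ)) (x : EuclideanSpace ℝ (Fin m)) :=
  (smooth_contDiffAt f x).differentiableAt (by simp)

theorem eventuallyEq_zeroExt {u v : EuclideanSpace ℝ (Fin m) → ℂ}
    (h : ∀ y : Ω, u y = v y) (x : Ω) : u =ᶠ[𝓝 (x : EuclideanSpace ℝ (Fin m))] v :=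
  Filter.eventuallyEq_of_mem (Ω.isOpen.mem_nhds x.2) fun y hy => h ⟨y, hy⟩

theorem smooth_continuous (f : SmoothFun Ω) : Continuous (f : Ω → ℂ) := by
  have h : ContinuousOn (zeroExt (f : Ω → ℂ)) (Ω : Set (EuclideanSpace ℝ (Fin m))) :=
    ContDiffOn.continuousOn f.2
  have h2 : Continuous fun x : Ω => zeroExt (f : Ω → ℂ) (x : EuclideanSpace ℝ (Fin m)) :=
    h.comp_continuous continuous_subtype_val fun x => x.2
  simpa only [zeroExt_coe] using h2

end Smooth

/-- The partial derivative `∂_i` on `C^∞(Ω)`. -/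
def pderiv {m : ℕ} {Ω : Opens (EuclideanSpace ℝ (Fin m))} (i : Fin m) :
    SmoothFun Ω →ₗ[ℂ] SmoothFun Ω where
  toFun f := ⟨fun x => fderiv ℝ (zeroExt (f : Ω → ℂ)) x (EuclideanSpace.single i 1), by
    have h1 : ContDiffOn ℝ ∞ (fderiv ℝ (zeroExt (f : Ω → ℂ)))
        (Ω : Set (EuclideanSpace ℝ (Fin m))) :=
      ContDiffOn.fderiv_of_isOpen f.2 Ω.isOpen (by simp)
    refine (h1.clm_apply (contDiffOn_const (c := EuclideanSpace.single i 1))).congr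
      fun x hx => ?_
    rw [zeroExt_of_mem _ (SetLike.mem_coe.1 hx)]⟩
  map_add' f g := by
    ext x
    have h : zeroExt ((f + g : SmoothFun Ω) : Ω → ℂ)
        =ᶠ[𝓝 (x : EuclideanSpace ℝ (Fin m))] zeroExt (f : Ω → ℂ) + zeroExt (g : Ω → ℂ) :=
      eventuallyEq_zeroExt (fun y => by simp [zeroExt_coe]) x
    change fderiv ℝ (zeroExt ((f + g : SmoothFun Ω) : Ω → ℂ)) x _
      = fderiv ℝ (zeroExt (f : Ω → ℂ)) x _ + fderiv ℝ (zeroExt (g : Ω → ℂ)) x _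
    rw [h.fderiv_eq, fderiv_add (smooth_differentiableAt f x) (smooth_differentiableAt g x)]
    rfl
  map_smul' c f := by
    ext x
    have h : zeroExt ((c • f : SmoothFun Ω) : Ω → ℂ)
        =ᶠ[𝓝 (x : EuclideanSpace ℝ (Fin m))] c • zeroExt (f : Ω → ℂ) :=
      eventuallyEq_zeroExt (fun y => by simp [zeroExt_coe]) x
    change fderiv ℝ (zeroExt ((c • f : SmoothFun Ω) : Ω → ℂ)) x _
      = c • fderiv ℝ (zeroExt (f : Ω → ℂ)) x _
    rw [h.fderiv_eq, fderiv_const_smul (smooth_differentiableAt f x)]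
    rfl

section Smooth

variable {m : ℕ} {Ω : Opens (EuclideanSpace ℝ (Fin m))}

theorem pderiv_apply (i : Fin m) (f : SmoothFun Ω) (x : Ω) :
    (pderiv i f : Ω → ℂ) x
      = fderiv ℝ (zeroExt (f : Ω → ℂ)) x (EuclideanSpace.single i 1) := rfl

theorem pderiv_mul (i : Fin m) (f g : SmoothFun Ω) :
    pderiv i (f * g) = pderiv i f * g + f * pderiv i g := by
  ext x
  have h : zeroExt ((f * g : SmoothFun Ω) : Ω → ℂ)
      =ᶠ[𝓝 (x : EuclideanSpace ℝ (Fin m))] zeroExt (f : Ω → ℂ) * zeroExt (g : Ω → ℂ) :=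
    eventuallyEq_zeroExt (fun y => by simp [zeroExt_coe]) x
  change fderiv ℝ (zeroExt ((f * g : SmoothFun Ω) : Ω → ℂ)) x _
    = fderiv ℝ (zeroExt (f : Ω → ℂ)) x _ * (g : Ω → ℂ) x
      + (f : Ω → ℂ) x * fderiv ℝ (zeroExt (g : Ω → ℂ)) x _
  rw [h.fderiv_eq, fderiv_mul (smooth_differentiableAt f x) (smooth_differentiableAt g x)]
  simp only [add_apply, smul_apply, smul_eq_mul,
    zeroExt_coe]
  ring

theorem pderiv_commute (i j : Fin m) :
    Commute (pderiv i : Module.End ℂ (SmoothFun Ω)) (pderiv j) := by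
  have key : ∀ (k l : Fin m) (f : SmoothFun Ω) (x : Ω),
      (pderiv k (pderiv l f) : Ω → ℂ) x
        = fderiv ℝ (fderiv ℝ (zeroExt (f : Ω → ℂ))) x
            (EuclideanSpace.single k 1) (EuclideanSpace.single l 1) := by
    intro k l f x
    have h : zeroExt ((pderiv l f : SmoothFun Ω) : Ω → ℂ)
        =ᶠ[𝓝 (x : EuclideanSpace ℝ (Fin m))]
          fun y => fderiv ℝ (zeroExt (f : Ω → ℂ)) y (EuclideanSpace.single l 1) :=
      eventuallyEq_zeroExt (fun y => by rw [zeroExt_coe, pderiv_apply]) x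
    have hd : DifferentiableAt ℝ (fderiv ℝ (zeroExt (f : Ω → ℂ)))
        (x : EuclideanSpace ℝ (Fin m)) :=
      ((smooth_contDiffAt f x).fderiv_right (m := 1) (by norm_cast)).differentiableAt (by simp)
    rw [pderiv_apply, h.fderiv_eq, fderiv_clm_apply hd (differentiableAt_const _)]
    simp
  refine LinearMap.ext fun f => Subtype.ext (funext fun x => ?_)
  change (pderiv i (pderiv j f) : Ω → ℂ) x = (pderiv j (pderiv i f) : Ω → ℂ) x
  rw [key, key]
  exact ((smooth_contDiffAt f x).isSymmSndFDerivAt (by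
    simpa using (WithTop.coe_le_coe.2 (le_top : (2 : ℕ∞) ≤ ⊤)))) _ _

end Smooth

theorem pderiv_pow_pairwise {m : ℕ} {Ω : Opens (EuclideanSpace ℝ (Fin m))} (α β : Fin m → ℕ) :
    ((Finset.univ : Finset (Fin m)) : Set (Fin m)).Pairwise fun i j =>
      Commute ((pderiv i : Module.End ℂ (SmoothFun Ω)) ^ α i) (pderiv j ^ β j) :=
  fun i _ j _ _ => (pderiv_commute i j).pow_pow (α i) (β j)

/-- The derivative `∂^α = ∏_i ∂_i^{α_i}` on `C^∞(Ω)`; the factors commute. -/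
def mderiv {m : ℕ} {Ω : Opens (EuclideanSpace ℝ (Fin m))} (α : Fin m → ℕ) :
    Module.End ℂ (SmoothFun Ω) :=
  Finset.univ.noncommProd (fun i => (pderiv i : Module.End ℂ (SmoothFun Ω)) ^ α i)
    (pderiv_pow_pairwise α α)

section Smooth

variable {m : ℕ} {Ω : Opens (EuclideanSpace ℝ (Fin m))}

theorem mderiv_zero : (mderiv 0 : Module.End ℂ (SmoothFun Ω)) = 1 :=
  (Finset.noncommProd_eq_pow_card _ _ _ 1 fun i _ => by simp).trans (one_pow _)

theorem mderiv_add (α β : Fin m → ℕ) :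
    (mderiv (α + β) : Module.End ℂ (SmoothFun Ω)) = mderiv α * mderiv β := by
  have h := Finset.noncommProd_mul_distrib (s := (Finset.univ : Finset (Fin m)))
    (fun i => (pderiv i : Module.End ℂ (SmoothFun Ω)) ^ α i) (fun i => pderiv i ^ β i)
    (pderiv_pow_pairwise α α) (pderiv_pow_pairwise β β) (pderiv_pow_pairwise β α)
  refine Eq.trans ?_ h
  exact Finset.noncommProd_congr rfl (fun i _ => by simp [pow_add]) _

theorem mderiv_single (i : Fin m) :
    (mderiv (Pi.single i 1) : Module.End ℂ (SmoothFun Ω)) = pderiv i := by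
  have hc := (pderiv_pow_pairwise (Ω := Ω) (Pi.single i 1) (Pi.single i 1)).mono
    (t := ((Finset.univ.erase i : Finset (Fin m)) : Set (Fin m)))
    fun _ _ => Finset.mem_coe.2 (Finset.mem_univ _)
  have h : (Finset.univ.erase i).noncommProd
      (fun j => (pderiv j : Module.End ℂ (SmoothFun Ω)) ^ (Pi.single i 1 : Fin m → ℕ) j)
      hc = 1 :=
    (Finset.noncommProd_eq_pow_card _ _ _ 1 fun j hj => by
      simp [Finset.ne_of_mem_erase hj]).trans (one_pow _)
  refine (Finset.noncommProd_erase_mul _ (Finset.mem_univ i) _ _ hc).symm.trans ?_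
  rw [h]
  simp

end Smooth

/-! ## Moderate, null and regular nets -/

/-- Nets `(f_ε)_ε`, `ε ∈ ]0,1]`, of smooth functions on `Ω`. -/
abbrev Net {m : ℕ} (Ω : Opens (EuclideanSpace ℝ (Fin m))) : Type :=
  Ioc (0 : ℝ) 1 → SmoothFun Ω

/-- The weight `ε^{-1/(2σ-1)}`. -/
def weight (σ : ℝ) (ε : Ioc (0 : ℝ) 1) : ℝ := (ε : ℝ) ^ (-(1 / (2 * σ - 1)))

/-- `sup_K |f_ε| ≤ c exp (k ε^{-1/(2σ-1)})` for small `ε`, for some `k > 0`, on every compact `K`. -/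
def ModerateBound {m : ℕ} {Ω : Opens (EuclideanSpace ℝ (Fin m))} (σ : ℝ) (f : Net Ω) : Prop :=
  ∀ K : Set Ω, IsCompact K → ∃ k > (0 : ℝ), ∃ c > (0 : ℝ), ∃ ε₀ : Ioc (0 : ℝ) 1,
    ∀ ε ≤ ε₀, ∀ x ∈ K, ‖(f ε : Ω → ℂ) x‖ ≤ c * Real.exp (k * weight σ ε)

/-- `sup_K |f_ε| ≤ c exp (-k ε^{-1/(2σ-1)})` for small `ε`, for all `k > 0`, on every compact `K`. -/
def NullBound {m : ℕ} {Ω : Opens (EuclideanSpace ℝ (Fin m))} (σ : ℝ) (f : Net Ω) : Prop :=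
  ∀ K : Set Ω, IsCompact K → ∀ k > (0 : ℝ), ∃ c > (0 : ℝ), ∃ ε₀ : Ioc (0 : ℝ) 1,
    ∀ ε ≤ ε₀, ∀ x ∈ K, ‖(f ε : Ω → ℂ) x‖ ≤ c * Real.exp (-k * weight σ ε)

/-- Moderate nets. -/
def IsModerate {m : ℕ} {Ω : Opens (EuclideanSpace ℝ (Fin m))} (σ : ℝ) (f : Net Ω) : Prop :=
  ∀ α : Fin m → ℕ, ModerateBound σ fun ε => mderiv α (f ε)

/-- Null nets. -/
def IsNull {m : ℕ} {Ω : Opens (EuclideanSpace ℝ (Fin m))} (σ : ℝ) (f : Net Ω) : Prop :=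
  ∀ α : Fin m → ℕ, NullBound σ fun ε => mderiv α (f ε)

/-- Regular nets: the constants `k`, `c`, `ε₀` depend on the compact `K`, but not on `α`. -/
def IsRegular {m : ℕ} {Ω : Opens (EuclideanSpace ℝ (Fin m))} (σ : ℝ) (f : Net Ω) : Prop :=
  ∀ K : Set Ω, IsCompact K → ∃ k > (0 : ℝ), ∃ c > (0 : ℝ), ∃ ε₀ : Ioc (0 : ℝ) 1,
    ∀ α : Fin m → ℕ, ∀ ε ≤ ε₀, ∀ x ∈ K,
      ‖(mderiv α (f ε) : Ω → ℂ) x‖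
        ≤ c ^ ((∑ i, α i) + 1) * ((∏ i, (α i).factorial : ℕ) : ℝ) ^ σ
          * Real.exp (k * weight σ ε)

section Nets

variable {m : ℕ} {Ω : Opens (EuclideanSpace ℝ (Fin m))} {σ : ℝ}

theorem weight_nonneg (σ : ℝ) (ε : Ioc (0 : ℝ) 1) : 0 ≤ weight σ ε :=
  Real.rpow_nonneg ε.2.1.le _

theorem ModerateBound.add {f g : Net Ω} (hf : ModerateBound σ f) (hg : ModerateBound σ g) :
    ModerateBound σ (f + g) := by
  intro K hK
  obtain ⟨k₁, hk₁, c₁, hc₁, e₁, h₁⟩ := hf K hK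
  obtain ⟨k₂, hk₂, c₂, hc₂, e₂, h₂⟩ := hg K hK
  refine ⟨k₁ + k₂, by positivity, c₁ + c₂, by positivity, min e₁ e₂, fun ε hε x hx => ?_⟩
  have a₁ := h₁ ε (hε.trans (min_le_left _ _)) x hx
  have a₂ := h₂ ε (hε.trans (min_le_right _ _)) x hx
  have w := weight_nonneg σ ε
  have b₁ : Real.exp (k₁ * weight σ ε) ≤ Real.exp ((k₁ + k₂) * weight σ ε) := by
    gcongr; linarith
  have b₂ : Real.exp (k₂ * weight σ ε) ≤ Real.exp ((k₁ + k₂) * weight σ ε) := by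
    gcongr; linarith
  calc ‖((f + g) ε : Ω → ℂ) x‖ ≤ ‖(f ε : Ω → ℂ) x‖ + ‖(g ε : Ω → ℂ) x‖ := norm_add_le _ _
    _ ≤ c₁ * Real.exp ((k₁ + k₂) * weight σ ε) + c₂ * Real.exp ((k₁ + k₂) * weight σ ε) := by
        gcongr
        · exact a₁.trans (by gcongr)
        · exact a₂.trans (by gcongr)
    _ = _ := by ring

theorem ModerateBound.mul {f g : Net Ω} (hf : ModerateBound σ f) (hg : ModerateBound σ g) :
    ModerateBound σ (f * g) := by
  intro K hK
  obtain ⟨k₁, hk₁, c₁, hc₁, e₁, h₁⟩ := hf K hK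
  obtain ⟨k₂, hk₂, c₂, hc₂, e₂, h₂⟩ := hg K hK
  refine ⟨k₁ + k₂, by positivity, c₁ * c₂, by positivity, min e₁ e₂, fun ε hε x hx => ?_⟩
  have a₁ := h₁ ε (hε.trans (min_le_left _ _)) x hx
  have a₂ := h₂ ε (hε.trans (min_le_right _ _)) x hx
  calc ‖((f * g) ε : Ω → ℂ) x‖ = ‖(f ε : Ω → ℂ) x‖ * ‖(g ε : Ω → ℂ) x‖ := norm_mul _ _
    _ ≤ (c₁ * Real.exp (k₁ * weight σ ε)) * (c₂ * Real.exp (k₂ * weight σ ε)) := by gcongr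
    _ = _ := by rw [add_mul, Real.exp_add]; ring

theorem NullBound.add {f g : Net Ω} (hf : NullBound σ f) (hg : NullBound σ g) :
    NullBound σ (f + g) := by
  intro K hK k hk
  obtain ⟨c₁, hc₁, e₁, h₁⟩ := hf K hK k hk
  obtain ⟨c₂, hc₂, e₂, h₂⟩ := hg K hK k hk
  refine ⟨c₁ + c₂, by positivity, min e₁ e₂, fun ε hε x hx => ?_⟩
  have a₁ := h₁ ε (hε.trans (min_le_left _ _)) x hx
  have a₂ := h₂ ε (hε.trans (min_le_right _ _)) x hx
  calc ‖((f + g) ε : Ω → ℂ) x‖ ≤ ‖(f ε : Ω → ℂ) x‖ + ‖(g ε : Ω → ℂ) x‖ := norm_add_le _ _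
    _ ≤ c₁ * Real.exp (-k * weight σ ε) + c₂ * Real.exp (-k * weight σ ε) := by gcongr
    _ = _ := by ring

theorem ModerateBound.mul_null {f g : Net Ω} (hf : ModerateBound σ f) (hg : NullBound σ g) :
    NullBound σ (f * g) := by
  intro K hK k hk
  obtain ⟨k₁, hk₁, c₁, hc₁, e₁, h₁⟩ := hf K hK
  obtain ⟨c₂, hc₂, e₂, h₂⟩ := hg K hK (k₁ + k) (by positivity)
  refine ⟨c₁ * c₂, by positivity, min e₁ e₂, fun ε hε x hx => ?_⟩
  have a₁ := h₁ ε (hε.trans (min_le_left _ _)) x hx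
  have a₂ := h₂ ε (hε.trans (min_le_right _ _)) x hx
  calc ‖((f * g) ε : Ω → ℂ) x‖ = ‖(f ε : Ω → ℂ) x‖ * ‖(g ε : Ω → ℂ) x‖ := norm_mul _ _
    _ ≤ (c₁ * Real.exp (k₁ * weight σ ε)) * (c₂ * Real.exp (-(k₁ + k) * weight σ ε)) := by
        gcongr
    _ = c₁ * c₂ * (Real.exp (k₁ * weight σ ε) * Real.exp (-(k₁ + k) * weight σ ε)) := by ring
    _ = _ := by rw [← Real.exp_add]; ring_nf

/-- If products of nets in the classes `P` and `Q` are in the class `R`, the same holds for the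
classes of nets all of whose derivatives are in `P`, `Q`, `R`. -/
theorem mderiv_mul_mem {P Q R : Net Ω → Prop} (hR : ∀ f g, R f → R g → R (f + g))
    (hPQ : ∀ f g, P f → Q g → R (f * g)) (α : Fin m → ℕ) :
    ∀ f g : Net Ω, (∀ β, P fun ε => mderiv β (f ε)) → (∀ β, Q fun ε => mderiv β (g ε)) →
      R fun ε => mderiv α (f ε * g ε) := by
  induction hn : ∑ i, α i generalizing α with
  | zero =>
    intro f g hf hg
    have h0 : α = 0 := by
      funext i
      simpa using (Finset.sum_eq_zero_iff.1 hn) i (Finset.mem_univ i)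
    have h1 := hf 0
    have h2 := hg 0
    simp only [h0, mderiv_zero, Module.End.one_apply] at h1 h2 ⊢
    exact hPQ _ _ h1 h2
  | succ n ih =>
    intro f g hf hg
    obtain ⟨i, hi⟩ : ∃ i, α i ≠ 0 := by
      by_contra! h
      simp [h] at hn
    obtain ⟨β, rfl⟩ : ∃ β : Fin m → ℕ, α = β + Pi.single i 1 := by
      refine ⟨α - Pi.single i 1, (tsub_add_cancel_of_le ?_).symm⟩
      intro j
      by_cases hj : j = i
      · subst hj; simpa [Nat.one_le_iff_ne_zero] using hi
      · simp [hj]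
    have hβ : ∑ i, β i = n := by
      simp only [Pi.add_apply, Finset.sum_add_distrib, Finset.sum_pi_single', Finset.mem_univ,
        if_true] at hn
      omega
    have shift : ∀ {S : Net Ω → Prop} (u : Net Ω), (∀ β, S fun ε => mderiv β (u ε)) →
        ∀ β, S fun ε => mderiv β (pderiv i (u ε)) := by
      intro S u hu β
      have := hu (β + Pi.single i 1)
      simpa only [mderiv_add, mderiv_single, Module.End.mul_apply] using this
    have e : (fun ε => mderiv (β + Pi.single i 1) (f ε * g ε))
        = (fun ε => mderiv β (pderiv i (f ε) * g ε))
          + fun ε => mderiv β (f ε * pderiv i (g ε)) := by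
      funext ε
      simp only [mderiv_add, mderiv_single, Module.End.mul_apply, pderiv_mul, map_add,
        Pi.add_apply]
    rw [e]
    exact hR _ _ (ih β hβ (fun ε => pderiv i (f ε)) g (shift f hf) hg)
      (ih β hβ f (fun ε => pderiv i (g ε)) hf (shift g hg))

theorem isModerate_const (g : SmoothFun Ω) : IsModerate σ fun _ => g := by
  intro α K hK
  obtain ⟨C, hC⟩ := hK.exists_bound_of_continuousOn (smooth_continuous (mderiv α g)).continuousOn
  refine ⟨1, one_pos, max C 1, by positivity, ⟨1, by simp⟩, fun ε _ x hx => ?_⟩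
  have h1 : 1 ≤ Real.exp (1 * weight σ ε) :=
    Real.one_le_exp (by simpa using weight_nonneg σ ε)
  calc _ ≤ C := hC x hx
    _ ≤ max C 1 := le_max_left _ _
    _ ≤ max C 1 * Real.exp (1 * weight σ ε) := le_mul_of_one_le_right (by positivity) h1

theorem IsModerate.mderiv {f : Net Ω} (hf : IsModerate σ f) (α : Fin m → ℕ) :
    IsModerate σ fun ε => mderiv α (f ε) := by
  intro β
  simpa only [mderiv_add, Module.End.mul_apply] using hf (β + α)

theorem IsNull.mderiv {f : Net Ω} (hf : IsNull σ f) (α : Fin m → ℕ) :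
    IsNull σ fun ε => mderiv α (f ε) := by
  intro β
  simpa only [mderiv_add, Module.End.mul_apply] using hf (β + α)

end Nets

/-- The algebra `𝓔_m^σ(Ω)` of moderate nets. -/
def Moderate {m : ℕ} (σ : ℝ) (Ω : Opens (EuclideanSpace ℝ (Fin m))) : Subalgebra ℂ (Net Ω) where
  carrier := {f | IsModerate σ f}
  mul_mem' {f g} hf hg α :=
    mderiv_mul_mem (fun _ _ => ModerateBound.add) (fun _ _ => ModerateBound.mul) α f g hf hg
  add_mem' {f g} hf hg α := by
    have h := (hf α).add (hg α)
    have e : ((fun ε => mderiv α (f ε)) + fun ε => mderiv α (g ε))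
        = fun ε => mderiv α ((f + g) ε) := by
      funext ε; simp
    exact e ▸ h
  algebraMap_mem' c := isModerate_const (algebraMap ℂ (SmoothFun Ω) c)

instance instCommRingModerate {m : ℕ} (σ : ℝ) (Ω : Opens (EuclideanSpace ℝ (Fin m))) :
    CommRing (Moderate σ Ω) :=
  inferInstance

/-- The ideal `𝓝^σ(Ω)` of null nets. -/
def Null {m : ℕ} (σ : ℝ) (Ω : Opens (EuclideanSpace ℝ (Fin m))) : Ideal (Moderate σ Ω) where
  carrier := {f | IsNull σ (f : Net Ω)}
  zero_mem' := fun α K _ k _ => ⟨1, one_pos, ⟨1, by simp⟩, fun ε _ x _ => by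
    simp [(Real.exp_pos _).le]⟩
  add_mem' {f g} hf hg α := by
    have h := (hf α).add (hg α)
    have e : ((fun ε => mderiv α ((f : Net Ω) ε)) + fun ε => mderiv α ((g : Net Ω) ε))
        = fun ε => mderiv α (((f + g : Moderate σ Ω) : Net Ω) ε) := by
      funext ε; simp
    exact e ▸ h
  smul_mem' f g hg α :=
    mderiv_mul_mem (fun _ _ => NullBound.add) (fun _ _ => ModerateBound.mul_null) α
      (f : Net Ω) (g : Net Ω) f.2 hg

/-! ## Generalized Gevrey ultradistributions -/

/-- The algebra `𝓖^σ(Ω) = 𝓔_m^σ(Ω) / 𝓝^σ(Ω)` of generalized Gevrey ultradistributions. -/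
abbrev G {m : ℕ} (σ : ℝ) (Ω : Opens (EuclideanSpace ℝ (Fin m))) : Type :=
  (Moderate σ Ω) ⧸ (Null σ Ω)

/-- The class in `𝓖^σ(Ω)` of a moderate net. -/
def cl {m : ℕ} {σ : ℝ} {Ω : Opens (EuclideanSpace ℝ (Fin m))} (f : Moderate σ Ω) : G σ Ω :=
  Ideal.Quotient.mk (Null σ Ω) f

/-- The derivative `∂^α` on `𝓖^σ(Ω)`, given by `∂^α cl (f_ε) = cl (∂^α f_ε)`. -/
def gderiv {m : ℕ} {σ : ℝ} {Ω : Opens (EuclideanSpace ℝ (Fin m))} (α : Fin m → ℕ) :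
    G σ Ω → G σ Ω :=
  Quotient.map' (fun f => ⟨fun ε => mderiv α ((f : Net Ω) ε), IsModerate.mderiv f.2 α⟩) (by
    intro f g hfg
    rw [Submodule.quotientRel_def] at hfg ⊢
    have h : IsNull σ ((f - g : Moderate σ Ω) : Net Ω) := hfg
    have h' := h.mderiv α
    have e : (fun ε => mderiv α (((f - g : Moderate σ Ω) : Net Ω) ε))
        = (fun ε => mderiv α ((f : Net Ω) ε)) - fun ε => mderiv α ((g : Net Ω) ε) := by
      funext ε; simp
    rw [e] at h'
    exact h')

theorem gderiv_cl {m : ℕ} {σ : ℝ} {Ω : Opens (EuclideanSpace ℝ (Fin m))} (α : Fin m → ℕ)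
    (f : Moderate σ Ω) :
    gderiv α (cl f) = cl ⟨fun ε => mderiv α ((f : Net Ω) ε), IsModerate.mderiv f.2 α⟩ := rfl

/-- `𝓖^{σ,∞}(Ω)`, as a subset of `𝓖^σ(Ω)`: the classes of regular nets. -/
def regularElements {m : ℕ} (σ : ℝ) (Ω : Opens (EuclideanSpace ℝ (Fin m))) : Set (G σ Ω) :=
  {u | ∃ f : Moderate σ Ω, IsRegular σ (f : Net Ω) ∧ cl f = u}

/-- The class in `𝓖^σ(Ω)` of the constant net equal to a smooth function. -/
def ofSmooth {m : ℕ} {Ω : Opens (EuclideanSpace ℝ (Fin m))} (σ : ℝ) (φ : SmoothFun Ω) : G σ Ω :=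
  cl ⟨fun _ => φ, isModerate_const φ⟩

/-- The finite set of multi-indices `α` with `|α| ≤ N`. -/
def multiIndices (m N : ℕ) : Finset (Fin m → ℕ) :=
  (Fintype.piFinset fun _ => Finset.range (N + 1)).filter fun α => ∑ i, α i ≤ N

theorem mem_multiIndices {m N : ℕ} {α : Fin m → ℕ} :
    α ∈ multiIndices m N ↔ ∑ i, α i ≤ N := by
  simp only [multiIndices, Finset.mem_filter, Fintype.mem_piFinset, Finset.mem_range,
    and_iff_right_iff_imp]
  intro h i
  have := Finset.single_le_sum (f := α) (fun _ _ => Nat.zero_le _) (Finset.mem_univ i)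
  omega

/-- The differential operator `P(x,D) f = ∑_{|α| ≤ N} a_α D^α f` on `𝓖^σ(Ω)`, where
`D^α = (-i)^{|α|} ∂^α`. -/
def diffOp {m : ℕ} {σ : ℝ} {Ω : Opens (EuclideanSpace ℝ (Fin m))} (N : ℕ)
    (a : (Fin m → ℕ) → G σ Ω) (f : G σ Ω) : G σ Ω :=
  ∑ α ∈ multiIndices m N, a α * ((-Complex.I) ^ (∑ i, α i) • gderiv α f)

/-! ## The wave front -/

/-- The Gevrey class `E^σ(Ω)`. -/
def IsGevrey {m : ℕ} {Ω : Opens (EuclideanSpace ℝ (Fin m))} (σ : ℝ) (φ : SmoothFun Ω) : Prop :=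
  ∀ K : Set Ω, IsCompact K → ∃ c > (0 : ℝ), ∀ α : Fin m → ℕ, ∀ x ∈ K,
    ‖(mderiv α φ : Ω → ℂ) x‖ ≤ c ^ ((∑ i, α i) + 1) * ((∏ i, (α i).factorial : ℕ) : ℝ) ^ σ

/-- The space `D^σ(Ω)` of Gevrey functions with compact support in `Ω`. -/
def GevreyTest {m : ℕ} (σ : ℝ) (Ω : Opens (EuclideanSpace ℝ (Fin m))) : Set (SmoothFun Ω) :=
  {φ | IsGevrey σ φ ∧ HasCompactSupport (φ : Ω → ℂ)}

/-- The Fourier transform `∫ exp (-i x·ξ) u(x) dx` of a function on `Ω`, extended by zero. -/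
def fourier {m : ℕ} {Ω : Opens (EuclideanSpace ℝ (Fin m))} (u : SmoothFun Ω)
    (ξ : EuclideanSpace ℝ (Fin m)) : ℂ :=
  ∫ x : EuclideanSpace ℝ (Fin m),
    Complex.exp (-Complex.I * ((inner ℝ x ξ : ℝ) : ℂ)) * zeroExt (u : Ω → ℂ) x

/-- Open conic neighbourhoods of `ξ₀`. -/
def IsConicNhd {m : ℕ} (Γ : Set (EuclideanSpace ℝ (Fin m))) (ξ₀ : EuclideanSpace ℝ (Fin m)) :
    Prop :=
  IsOpen Γ ∧ ξ₀ ∈ Γ ∧ ∀ ξ ∈ Γ, ∀ t > (0 : ℝ), t • ξ ∈ Γ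

/-- The cone `Σ_g^σ(u) ⊆ ℝ^m ∖ {0}` of a compactly supported `u ∈ 𝓖^σ(Ω)`. Its complement consists
of the `ξ₀` with a conic neighbourhood `Γ` on which the Fourier transforms of a representative of
`u`, supported in a fixed compact subset of `Ω`, decay. -/
def singCone {m : ℕ} {σ : ℝ} {Ω : Opens (EuclideanSpace ℝ (Fin m))} (u : G σ Ω) :
    Set (EuclideanSpace ℝ (Fin m)) :=
  {ξ₀ | ξ₀ ≠ 0 ∧ ¬ ∃ Γ : Set (EuclideanSpace ℝ (Fin m)), IsConicNhd Γ ξ₀ ∧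
    ∃ f : Moderate σ Ω, cl f = u ∧
      (∃ K : Set Ω, IsCompact K ∧ ∀ ε, tsupport ((f : Net Ω) ε : Ω → ℂ) ⊆ K) ∧
      ∃ k₁ > (0 : ℝ), ∃ k₂ > (0 : ℝ), ∃ c > (0 : ℝ), ∃ ε₀ : Ioc (0 : ℝ) 1,
        ∀ ξ ∈ Γ, ∀ ε ≤ ε₀,
          ‖fourier ((f : Net Ω) ε) ξ‖
            ≤ c * Real.exp (k₁ * weight σ ε - k₂ * ‖ξ‖ ^ (1 / σ))}

/-- The cone of `σ`-singular directions of `f` at `x₀`: the intersection of the cones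
`Σ_g^σ(φ f)` over all `φ ∈ D^σ(Ω)` equal to `1` near `x₀`. -/
def singConeAt {m : ℕ} {σ : ℝ} {Ω : Opens (EuclideanSpace ℝ (Fin m))} (f : G σ Ω) (x₀ : Ω) :
    Set (EuclideanSpace ℝ (Fin m)) :=
  {ξ | ξ ≠ 0 ∧ ∀ φ ∈ GevreyTest σ Ω, (∀ᶠ x in 𝓝 x₀, (φ : Ω → ℂ) x = 1) →
    ξ ∈ singCone (ofSmooth σ φ * f)}

/-- The generalized Gevrey wave front `WF_g^σ(f) ⊆ Ω × (ℝ^m ∖ {0})`. -/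
def waveFront {m : ℕ} {σ : ℝ} {Ω : Opens (EuclideanSpace ℝ (Fin m))} (f : G σ Ω) :
    Set (Ω × EuclideanSpace ℝ (Fin m)) :=
  {p | p.2 ∈ singConeAt f p.1}

end GenGevrey

end

namespace GenGevrey

open MeasureTheory FourierTransform

/-! ### Locality of derivatives, and extension of compactly supported functions by zero -/

section Smooth

variable {m : ℕ} {Ω : Opens (EuclideanSpace ℝ (Fin m))}

/-! Suppose `ξ₀` is not singular for `φ f`, where `φ` is a Gevrey cutoff equal to 1 near `x₀`. A
second Gevrey cutoff `ψ`, also 1 near `x₀` and supported where `φ` is locally 1, is obtained by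
dilating `φ` about `x₀` (`exists_gevreyTest_shrink`). Derivatives are local, so `ψ ∂^α f = ψ ∂^α (φ
f)` and hence `ψ P f = ∑ (ψ a_α) D^α (φ f)`. It remains to see that each summand decays on a conic
neighbourhood of `ξ₀`.

Let `H` be a representative of `φ f` whose Fourier transforms decay on a cone `Γ`. The transform of
`∂^α H` only gains a polynomial factor, which the exponential absorbs (`DecaysOn.mderiv`). The
factor `ψ a_α` has Gevrey bounds uniform in the order of differentiation, so its transform decays
like `exp (-k |ξ|^{1/σ})` in every direction, up to a factor depending on `ε`
(`norm_fourier_le_of_gevrey_bound`).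

The transform of the product is a convolution (`norm_fourier_mul_le`). For `ξ` in a smaller cone, a
shift `ζ` with `|ζ| ≤ δ |ξ|` keeps `ξ + ζ` in `Γ`, where the second factor decays; for larger `ζ`
the first factor is itself small in terms of `|ξ|`, and the second need only be moderate
(`mul_le_exp_of_cone`). Integration over `ζ` gives `DecaysOn.mul`, and
`notMem_singCone_ofSmooth_mul_diffOp` assembles the sum. -/

theorem multiIndex_induction {P : (Fin m → ℕ) → Prop} (zero : P 0)
    (add_single : ∀ α i, P α → P (α + Pi.single i 1)) (α : Fin m → ℕ) : P α := by
  induction hn : ∑ i, α i generalizing α with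
  | zero =>
    have h0 : α = 0 := by
      funext i
      simpa using (Finset.sum_eq_zero_iff.1 hn) i (Finset.mem_univ i)
    rwa [h0]
  | succ n ih =>
    obtain ⟨i, hi⟩ : ∃ i, α i ≠ 0 := by
      by_contra! h
      simp [h] at hn
    obtain ⟨β, rfl⟩ : ∃ β : Fin m → ℕ, α = β + Pi.single i 1 := by
      refine ⟨α - Pi.single i 1, (tsub_add_cancel_of_le ?_).symm⟩
      intro j
      by_cases hj : j = i
      · subst hj; simpa [Nat.one_le_iff_ne_zero] using hi
      · simp [hj]
    refine add_single _ _ (ih β ?_)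
    simp only [Pi.add_apply, Finset.sum_add_distrib, Finset.sum_pi_single', Finset.mem_univ,
      if_true] at hn
    omega

theorem mderiv_add_single (α : Fin m → ℕ) (i : Fin m) (u : SmoothFun Ω) :
    mderiv (α + Pi.single i 1) u = mderiv α (pderiv i u) := by
  rw [mderiv_add, mderiv_single, Module.End.mul_apply]

theorem mderiv_add_single' (α : Fin m → ℕ) (i : Fin m) (u : SmoothFun Ω) :
    mderiv (α + Pi.single i 1) u = pderiv i (mderiv α u) := by
  rw [add_comm, mderiv_add, mderiv_single, Module.End.mul_apply]

theorem mderiv_pi_single (i : Fin m) (n : ℕ) :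
    (mderiv (Pi.single i n) : Module.End ℂ (SmoothFun Ω)) = pderiv i ^ n := by
  induction n with
  | zero => rw [Pi.single_zero, mderiv_zero, pow_zero]
  | succ n ih => rw [Pi.single_add, mderiv_add, mderiv_single, ih, pow_succ]

theorem pderiv_eventuallyEq {u v : SmoothFun Ω} {x : Ω} (h : (u : Ω → ℂ) =ᶠ[𝓝 x] v) (i : Fin m) :
    (pderiv i u : Ω → ℂ) =ᶠ[𝓝 x] (pderiv i v : Ω → ℂ) := by
  have h' : ∀ᶠ y : EuclideanSpace ℝ (Fin m) in 𝓝 (x : EuclideanSpace ℝ (Fin m)),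
      zeroExt (u : Ω → ℂ) y = zeroExt (v : Ω → ℂ) y := by
    rw [← map_nhds_subtype_val (s := (Ω : Set (EuclideanSpace ℝ (Fin m)))) x |>.trans
      (Ω.isOpen.nhdsWithin_eq x.2), eventually_map]
    filter_upwards [h] with y hy
    rw [zeroExt_coe, zeroExt_coe, hy]
  -- The derivative at a nearby `y` needs agreement near `y`, not only at `y`; `eventually_nhds`
  -- supplies this.
  have h2 := continuous_subtype_val.continuousAt.eventually h'.eventually_nhds
  filter_upwards [h2] with y hy
  rw [pderiv_apply, pderiv_apply]
  rw [Filter.EventuallyEq.fderiv_eq hy]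

theorem mderiv_eventuallyEq {u v : SmoothFun Ω} {x : Ω} (h : (u : Ω → ℂ) =ᶠ[𝓝 x] v)
    (α : Fin m → ℕ) : (mderiv α u : Ω → ℂ) =ᶠ[𝓝 x] (mderiv α v : Ω → ℂ) := by
  induction α using multiIndex_induction with
  | zero => rwa [mderiv_zero]
  | add_single α i ih => simpa only [mderiv_add_single'] using pderiv_eventuallyEq ih i

theorem tsupport_mderiv_subset (u : SmoothFun Ω) (α : Fin m → ℕ) :
    tsupport (mderiv α u : Ω → ℂ) ⊆ tsupport (u : Ω → ℂ) := by
  intro x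
  contrapose!
  rw [notMem_tsupport_iff_eventuallyEq, notMem_tsupport_iff_eventuallyEq]
  intro h
  have h' : (u : Ω → ℂ) =ᶠ[𝓝 x] ((0 : SmoothFun Ω) : Ω → ℂ) := h
  simpa using mderiv_eventuallyEq h' α

theorem zeroExt_of_notMem (f : Ω → ℂ) {x : EuclideanSpace ℝ (Fin m)} (hx : x ∉ Ω) :
    zeroExt f x = 0 :=
  Function.extend_apply' _ _ _ (by rintro ⟨y, rfl⟩; exact hx y.2)

theorem zeroExt_eq_zero (f : Ω → ℂ) {x : EuclideanSpace ℝ (Fin m)}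
    (hx : x ∉ Subtype.val '' tsupport f) : zeroExt f x = 0 := by
  by_cases h : x ∈ Ω
  · rw [zeroExt_of_mem _ h]
    exact image_eq_zero_of_notMem_tsupport fun h' => hx ⟨_, h', rfl⟩
  · exact zeroExt_of_notMem f h

/-- A support merely closed in `Ω` could accumulate at the boundary; a compact one has a closed
image in the whole space. -/
theorem tsupport_zeroExt_subset {f : Ω → ℂ} (hf : HasCompactSupport f) :
    tsupport (zeroExt f) ⊆ Subtype.val '' tsupport f := by
  refine closure_minimal (fun x hx => ?_) (hf.isCompact.image continuous_subtype_val).isClosed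
  by_contra h
  exact hx (zeroExt_eq_zero f h)

theorem hasCompactSupport_zeroExt {f : Ω → ℂ} (hf : HasCompactSupport f) :
    HasCompactSupport (zeroExt f) :=
  (hf.isCompact.image continuous_subtype_val).of_isClosed_subset (isClosed_tsupport _)
    (tsupport_zeroExt_subset hf)

/-- Each point either lies in `Ω` or has a neighbourhood on which the extension vanishes. This gives
access to the Fourier theory of Schwartz functions. -/
theorem contDiff_zeroExt {u : SmoothFun Ω} (hu : HasCompactSupport (u : Ω → ℂ)) :
    ContDiff ℝ ∞ (zeroExt (u : Ω → ℂ)) := by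
  refine contDiff_iff_contDiffAt.2 fun x => ?_
  by_cases hx : x ∈ tsupport (zeroExt (u : Ω → ℂ))
  · obtain ⟨y, -, rfl⟩ := tsupport_zeroExt_subset hu hx
    exact smooth_contDiffAt u y
  · exact contDiffAt_const.congr_of_eventuallyEq (notMem_tsupport_iff_eventuallyEq.1 hx)

/-- A compactly supported smooth function on `Ω`, extended by zero, as a Schwartz function. -/
noncomputable def toSchwartz (u : SmoothFun Ω) (hu : HasCompactSupport (u : Ω → ℂ)) :
    SchwartzMap (EuclideanSpace ℝ (Fin m)) ℂ :=
  (hasCompactSupport_zeroExt hu).toSchwartzMap (contDiff_zeroExt hu)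

theorem zeroExt_mul (u v : SmoothFun Ω) (x : EuclideanSpace ℝ (Fin m)) :
    zeroExt ((u * v : SmoothFun Ω) : Ω → ℂ) x
      = zeroExt (u : Ω → ℂ) x * zeroExt (v : Ω → ℂ) x := by
  by_cases h : x ∈ Ω
  · simp [zeroExt_of_mem _ h]
  · simp [zeroExt_of_notMem _ h]

theorem zeroExt_pderiv {u : SmoothFun Ω} (hu : HasCompactSupport (u : Ω → ℂ)) (i : Fin m)
    (x : EuclideanSpace ℝ (Fin m)) :
    zeroExt (pderiv i u : Ω → ℂ) x
      = fderiv ℝ (zeroExt (u : Ω → ℂ)) x (EuclideanSpace.single i 1) := by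
  by_cases h : x ∈ Ω
  · rw [zeroExt_of_mem _ h, pderiv_apply]
  · rw [zeroExt_of_notMem _ h]
    have h1 : x ∉ tsupport (zeroExt (u : Ω → ℂ)) := fun h' => by
      obtain ⟨y, -, rfl⟩ := tsupport_zeroExt_subset hu h'
      exact h y.2
    rw [(notMem_tsupport_iff_eventuallyEq.1 h1).fderiv_eq]
    simp

/-! ### The Fourier transform -/

theorem fourier_eq (u : SmoothFun Ω) (ξ : EuclideanSpace ℝ (Fin m)) :
    fourier u ξ = 𝓕 (zeroExt (u : Ω → ℂ)) ((2 * Real.pi)⁻¹ • ξ) := by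
  rw [Real.fourier_eq', fourier]
  congr 1
  ext x
  rw [smul_eq_mul, inner_smul_right]
  congr 2
  push_cast
  field_simp

theorem fourier_smul_eq (u : SmoothFun Ω) (ξ : EuclideanSpace ℝ (Fin m)) :
    𝓕 (zeroExt (u : Ω → ℂ)) ξ = fourier u ((2 * Real.pi) • ξ) := by
  rw [fourier_eq, smul_smul, inv_mul_cancel₀ (by positivity), one_smul]

theorem norm_fourier_le {u : SmoothFun Ω} {K : Set Ω} (hK : IsCompact K)
    (hu : tsupport (u : Ω → ℂ) ⊆ K) {C : ℝ} (hC : ∀ x ∈ K, ‖(u : Ω → ℂ) x‖ ≤ C)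
    (ξ : EuclideanSpace ℝ (Fin m)) :
    ‖fourier u ξ‖ ≤ C * volume.real (Subtype.val '' K) := by
  have h0 : ∀ x ∉ Subtype.val '' K, Complex.exp (-Complex.I * ((inner ℝ x ξ : ℝ) : ℂ))
      * zeroExt (u : Ω → ℂ) x = 0 := fun x hx => by
    rw [zeroExt_eq_zero _ (fun h => hx (image_mono hu h)), mul_zero]
  rw [fourier, ← setIntegral_eq_integral_of_forall_compl_eq_zero h0]
  refine norm_setIntegral_le_of_norm_le_const
    (hK.image continuous_subtype_val).measure_lt_top ?_
  rintro _ ⟨x, hx, rfl⟩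
  rw [norm_mul, zeroExt_coe, Complex.norm_exp]
  simpa using hC x hx

open LineDeriv in
theorem fourier_pderiv {u : SmoothFun Ω} (hu : HasCompactSupport (u : Ω → ℂ)) (i : Fin m)
    (ξ : EuclideanSpace ℝ (Fin m)) :
    fourier (pderiv i u) ξ = Complex.I * (ξ i : ℂ) * fourier u ξ := by
  have h4 : zeroExt (pderiv i u : Ω → ℂ)
      = (∂_{EuclideanSpace.single i (1 : ℝ)} (toSchwartz u hu) :
        SchwartzMap (EuclideanSpace ℝ (Fin m)) ℂ) :=
    funext fun x => by
      rw [SchwartzMap.lineDerivOp_apply_eq_fderiv]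
      exact zeroExt_pderiv hu i x
  have ht : (inner ℝ · (EuclideanSpace.single i (1 : ℝ)) :
      EuclideanSpace ℝ (Fin m) → ℝ).HasTemperateGrowth :=
    ((innerSL ℝ).flip (EuclideanSpace.single i (1 : ℝ))).hasTemperateGrowth
  rw [fourier_eq, h4, ← SchwartzMap.fourier_coe, SchwartzMap.fourier_lineDerivOp_eq, fourier_eq,
    smul_apply, SchwartzMap.smulLeftCLM_apply_apply ht, SchwartzMap.fourier_coe]
  have h5 : inner ℝ ((2 * Real.pi)⁻¹ • ξ) (EuclideanSpace.single i (1 : ℝ))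
      = (2 * Real.pi)⁻¹ * ξ i := by
    simp [EuclideanSpace.inner_single_right]
  rw [h5]
  change _ • (_ • 𝓕 (zeroExt (u : Ω → ℂ)) _) = _
  rw [Complex.real_smul, smul_eq_mul]
  push_cast
  have := Real.pi_ne_zero
  field_simp

/-- The transform of a product is the convolution of the transforms. The integration variable is the
frequency for the normalisation `exp (-2πi x·t)`, so factors `2π` appear in the arguments but none
in front of the integral. -/
theorem norm_fourier_mul_le {u v : SmoothFun Ω} (hu : HasCompactSupport (u : Ω → ℂ))
    (hv : HasCompactSupport (v : Ω → ℂ)) (ξ : EuclideanSpace ℝ (Fin m)) :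
    ‖fourier (u * v) ξ‖
      ≤ ∫ t, ‖fourier u (-((2 * Real.pi) • t))‖ * ‖fourier v (ξ + (2 * Real.pi) • t)‖ := by
  set b := toSchwartz u hu with hb
  set g := toSchwartz v hv with hg
  have hinv : ∀ (w : SmoothFun Ω) (hw : HasCompactSupport (w : Ω → ℂ))
      (t : EuclideanSpace ℝ (Fin m)),
      (𝓕⁻ (toSchwartz w hw)) t = fourier w (-((2 * Real.pi) • t)) := fun w hw t => by
    rw [SchwartzMap.fourierInv_coe, Real.fourierInv_eq_fourier_neg, ← smul_neg, ← fourier_smul_eq]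
    rfl
  -- The convolution theorem turns a convolution into a product; applying it to `𝓕⁻ b` and `𝓕⁻ g`
  -- and inverting gives the converse direction.
  have h1 : 𝓕⁻ (SchwartzMap.pairing (ContinuousLinearMap.mul ℂ ℂ) b g)
      = SchwartzMap.convolution (ContinuousLinearMap.mul ℂ ℂ) (𝓕⁻ b) (𝓕⁻ g) := by
    have h := SchwartzMap.fourier_convolution (ContinuousLinearMap.mul ℂ ℂ) (𝓕⁻ b) (𝓕⁻ g)
    rw [FourierTransform.fourier_fourierInv_eq, FourierTransform.fourier_fourierInv_eq] at h
    rw [← h, FourierTransform.fourierInv_fourier_eq]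
  have h2 : fourier (u * v) ξ
      = (𝓕⁻ (SchwartzMap.pairing (ContinuousLinearMap.mul ℂ ℂ) b g))
        (-((2 * Real.pi)⁻¹ • ξ)) := by
    have h3 : zeroExt ((u * v : SmoothFun Ω) : Ω → ℂ)
        = SchwartzMap.pairing (ContinuousLinearMap.mul ℂ ℂ) b g := funext (zeroExt_mul u v)
    rw [SchwartzMap.fourierInv_coe, Real.fourierInv_eq_fourier_neg, neg_neg, fourier_eq, h3]
  rw [h2, h1, SchwartzMap.convolution_apply]
  refine (norm_integral_le_integral_norm _).trans_eq ?_
  congr 1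
  ext t
  rw [ContinuousLinearMap.mul_apply', norm_mul, hinv, hinv]
  congr 3
  rw [smul_sub, smul_neg, smul_smul, mul_inv_cancel₀ (by positivity), one_smul]
  abel

end Smooth

/-! ### Exponential weights -/

/-- Taking `σ`-th roots turns `(n!)^σ` into `n!`. Weighting by `2^{-n} / n!` and summing over `n`
produces `exp (s / 2)` on the left, with `s = t^{1/σ}`, and a geometric series of sum 2 on the
right; then the `σ`-th power is taken. -/
theorem le_exp_neg_of_gevrey_bound {σ B M t : ℝ} (hσ : 0 < σ) (hB : 0 ≤ B) (hM : 0 ≤ M)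
    (ht : 0 ≤ t) (h : ∀ n : ℕ, t ^ n * B ≤ M * (n.factorial : ℝ) ^ σ) :
    B ≤ 2 ^ σ * M * Real.exp (-(σ / 2) * t ^ (1 / σ)) := by
  set s := t ^ (1 / σ) with hs
  set b := B ^ (1 / σ) with hb
  set μ := M ^ (1 / σ) with hμ
  have hs0 : 0 ≤ s := by positivity
  have hb0 : 0 ≤ b := by positivity
  have hμ0 : 0 ≤ μ := by positivity
  have hσi : (1 / σ) * σ = 1 := by field_simp
  have hroot : ∀ n : ℕ, s ^ n * b ≤ μ * n.factorial := fun n => by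
    have h1 := Real.rpow_le_rpow (by positivity) (h n) (by positivity : (0 : ℝ) ≤ 1 / σ)
    rw [Real.mul_rpow (by positivity) hB, Real.mul_rpow hM (by positivity),
      ← Real.rpow_mul (by positivity), mul_one_div_cancel hσ.ne', Real.rpow_one,
      ← Real.rpow_natCast, ← Real.rpow_mul ht, mul_comm (n : ℝ), Real.rpow_mul ht,
      Real.rpow_natCast] at h1
    exact h1
  have h2 : Real.exp (s / 2) * b ≤ 2 * μ := by
    have e1 : HasSum (fun n : ℕ => (s / 2) ^ n / n.factorial) (Real.exp (s / 2)) := by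
      rw [Real.exp_eq_exp_ℝ]
      exact NormedSpace.expSeries_div_hasSum_exp (s / 2)
    refine hasSum_le (fun n => ?_) (e1.mul_right b) (hasSum_geometric_two.mul_right μ)
    have hf : (0 : ℝ) < n.factorial := by positivity
    calc (s / 2) ^ n / n.factorial * b = (1 / 2) ^ n * (s ^ n * b / n.factorial) := by
          rw [div_eq_mul_one_div s, mul_pow]; ring
      _ ≤ (1 / 2) ^ n * μ := by
          gcongr
          rw [div_le_iff₀ hf]
          exact hroot n
  have h3 := Real.rpow_le_rpow (by positivity) h2 hσ.le
  rw [Real.mul_rpow (by positivity) hb0, Real.mul_rpow (by positivity) hμ0, hb, hμ,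
    ← Real.rpow_mul hB, ← Real.rpow_mul hM, hσi, Real.rpow_one, Real.rpow_one,
    ← Real.exp_mul] at h3
  calc B = Real.exp (s / 2 * σ) * B * Real.exp (-(σ / 2) * s) := by
        rw [mul_right_comm, ← Real.exp_add]
        ring_nf
        simp
    _ ≤ 2 ^ σ * M * Real.exp (-(σ / 2) * s) := by gcongr

theorem exists_one_add_pow_le_exp {σ k : ℝ} (hσ : 0 < σ) (hk : 0 < k) (p : ℕ) :
    ∃ C > (0 : ℝ), ∀ s : ℝ, 0 ≤ s → (1 + s) ^ p ≤ C * Real.exp (k * s ^ (1 / σ)) := by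
  set n := ⌈σ⌉₊ with hn
  -- The rate is shared among `p + 1` factors; using `p + 1` rather than `p` avoids a separate case
  -- `p = 0`.
  set κ := k / (p + 1) with hκ
  have hκ0 : 0 < κ := by positivity
  set C := 2 + n.factorial / κ ^ n with hC
  have hC0 : 0 < C := by positivity
  refine ⟨C ^ (p + 1), by positivity, fun s hs => ?_⟩
  set y := s ^ (1 / σ) with hy
  have hy0 : 0 ≤ y := by positivity
  have h1 : s ≤ 1 + y ^ n := by
    have hsy : s = y ^ σ := by
      rw [hy, ← Real.rpow_mul hs, one_div_mul_cancel hσ.ne', Real.rpow_one]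
    rcases le_total y 1 with h | h
    · have : s ≤ 1 := hsy ▸ Real.rpow_le_one hy0 h hσ.le
      have : 0 ≤ y ^ n := by positivity
      linarith
    · have : s ≤ y ^ n := by
        rw [hsy, ← Real.rpow_natCast]
        exact Real.rpow_le_rpow_of_exponent_le h (Nat.le_ceil σ)
      linarith
  have h2 : y ^ n ≤ n.factorial / κ ^ n * Real.exp (κ * y) := by
    have := Real.pow_div_factorial_le_exp (κ * y) (by positivity) n
    rw [mul_pow, div_le_iff₀ (by positivity)] at this
    rw [div_mul_eq_mul_div, le_div_iff₀ (by positivity)]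
    linarith
  have h3 : 1 + s ≤ C * Real.exp (κ * y) := by
    have : 1 ≤ Real.exp (κ * y) := Real.one_le_exp (by positivity)
    rw [hC, add_mul]
    linarith
  calc (1 + s) ^ p ≤ (1 + s) ^ (p + 1) := pow_le_pow_right₀ (by linarith) (by omega)
    _ ≤ (C * Real.exp (κ * y)) ^ (p + 1) := by gcongr
    _ = C ^ (p + 1) * Real.exp (k * y) := by
        rw [mul_pow, ← Real.exp_nat_mul, hκ]
        congr 2
        push_cast
        field_simp

section

variable {E : Type*} [NormedAddCommGroup E]

theorem integrable_exp_neg_norm_rpow [NormedSpace ℝ E] [FiniteDimensional ℝ E] [MeasurableSpace E]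
    [BorelSpace E] (μ : Measure E) [μ.IsAddHaarMeasure] {σ k : ℝ} (hσ : 0 < σ) (hk : 0 < k) :
    Integrable (fun x : E => Real.exp (-k * ‖x‖ ^ (1 / σ))) μ := by
  set d := Module.finrank ℝ E with hd
  obtain ⟨C, hC, h⟩ := exists_one_add_pow_le_exp hσ hk (d + 1)
  have hi : Integrable (fun x : E => (1 + ‖x‖) ^ (-((d + 1 : ℕ) : ℝ))) μ :=
    integrable_one_add_norm (by push_cast; linarith)
  have hc : Continuous fun x : E => Real.exp (-k * ‖x‖ ^ (1 / σ)) :=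
    Real.continuous_exp.comp (continuous_const.mul
      (continuous_norm.rpow_const fun _ => Or.inr (by positivity)))
  refine (hi.const_mul C).mono' hc.aestronglyMeasurable (Eventually.of_forall fun x => ?_)
  have h1 := h ‖x‖ (norm_nonneg x)
  rw [Real.norm_of_nonneg (Real.exp_pos _).le, Real.rpow_neg (by positivity), Real.rpow_natCast,
    neg_mul, Real.exp_neg, ← div_eq_mul_inv, inv_le_comm₀ (by positivity) (by positivity), inv_div,
    div_le_iff₀ hC]
  linarith

end

/-! ### Cones -/

variable {m : ℕ}

/-- `Γ'` is the cone over a ball half as large as one contained in `Γ`. Rescaling `ξ` into that ball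
makes `‖ξ‖` at most `‖ξ₀‖ + r`, so the rescaled `ζ` has length at most `r / 2` and stays within the
larger ball. The bound `δ ≤ 1 / 2` serves to keep `‖ξ + ζ‖` comparable to `‖ξ‖`. -/
theorem IsConicNhd.exists_shrink {Γ : Set (EuclideanSpace ℝ (Fin m))}
    {ξ₀ : EuclideanSpace ℝ (Fin m)} (h : IsConicNhd Γ ξ₀) :
    ∃ Γ' : Set (EuclideanSpace ℝ (Fin m)), IsConicNhd Γ' ξ₀ ∧ ∃ δ > (0 : ℝ), δ ≤ 1 / 2 ∧
      ∀ ξ ∈ Γ', ∀ ζ : EuclideanSpace ℝ (Fin m), ‖ζ‖ ≤ δ * ‖ξ‖ → ξ + ζ ∈ Γ := by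
  obtain ⟨ho, h0, hc⟩ := h
  obtain ⟨r, hr, hb⟩ := Metric.isOpen_iff.1 ho ξ₀ h0
  refine ⟨{ξ | ∃ t > (0 : ℝ), t • ξ ∈ Metric.ball ξ₀ (r / 2)}, ⟨?_, ?_, ?_⟩,
    min (1 / 2) (r / 2 / (‖ξ₀‖ + r)), by positivity, min_le_left _ _, ?_⟩
  · have : {ξ : EuclideanSpace ℝ (Fin m) | ∃ t > (0 : ℝ), t • ξ ∈ Metric.ball ξ₀ (r / 2)}
        = ⋃ t ∈ Ioi (0 : ℝ), (fun ξ => t • ξ) ⁻¹' Metric.ball ξ₀ (r / 2) := by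
      ext ξ; simp
    rw [this]
    exact isOpen_biUnion fun t _ => Metric.isOpen_ball.preimage (continuous_const_smul t)
  · exact ⟨1, one_pos, by simpa using hr⟩
  · rintro ξ ⟨s, hs, hξ⟩ t ht
    exact ⟨s / t, by positivity, by rwa [smul_smul, div_mul_cancel₀ _ ht.ne']⟩
  · rintro ξ ⟨t, ht, hξ⟩ ζ hζ
    rw [mem_ball_iff_norm] at hξ
    have h1 : t * ‖ξ‖ ≤ ‖ξ₀‖ + r := by
      have := norm_le_norm_add_norm_sub' (t • ξ) ξ₀
      rw [norm_smul, Real.norm_of_nonneg ht.le] at this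
      linarith
    have h2 : t * ‖ζ‖ ≤ r / 2 := by
      have hpos : 0 < ‖ξ₀‖ + r := by positivity
      calc t * ‖ζ‖ ≤ t * (min (1 / 2) (r / 2 / (‖ξ₀‖ + r)) * ‖ξ‖) := by gcongr
        _ = min (1 / 2) (r / 2 / (‖ξ₀‖ + r)) * (t * ‖ξ‖) := by ring
        _ ≤ r / 2 / (‖ξ₀‖ + r) * (‖ξ₀‖ + r) := by
            gcongr
            exact min_le_right _ _
        _ = r / 2 := by field_simp
    have h3 : t • (ξ + ζ) ∈ Γ := by
      apply hb
      rw [mem_ball_iff_norm, smul_add, add_sub_right_comm]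
      calc ‖t • ξ - ξ₀ + t • ζ‖ ≤ ‖t • ξ - ξ₀‖ + ‖t • ζ‖ := norm_add_le _ _
        _ < r / 2 + r / 2 := by
            rw [norm_smul t ζ, Real.norm_of_nonneg ht.le]
            exact add_lt_add_of_lt_of_le hξ h2
        _ = r := by ring
    have h4 := hc _ h3 t⁻¹ (by positivity)
    rwa [smul_smul, inv_mul_cancel₀ ht.ne', one_smul] at h4

/-- Pointwise estimate of the convolution integrand. Half of the decay of `U` is kept for
integrability in `ζ`. Decay in `ξ` comes from `V` when `ζ` is short, and from the other half of `U`
when `ζ` is long; hence the rate `min (k / 2) k₂`. -/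
theorem mul_le_exp_of_cone {Γ : Set (EuclideanSpace ℝ (Fin m))} {σ k k₂ A M δ : ℝ} (hσ : 0 < σ)
    (hk : 0 < k) (hk₂ : 0 < k₂) (hM : 0 ≤ M) (hδ : 0 < δ) (hδ' : δ ≤ 1 / 2)
    {U V : EuclideanSpace ℝ (Fin m) → ℝ} (hU0 : ∀ ζ, 0 ≤ U ζ)
    (hU : ∀ ζ, U ζ ≤ A * Real.exp (-k * ‖ζ‖ ^ (1 / σ))) (hV0 : ∀ η, 0 ≤ V η)
    (hV : ∀ η, V η ≤ M) (hVΓ : ∀ η ∈ Γ, V η ≤ M * Real.exp (-k₂ * ‖η‖ ^ (1 / σ)))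
    {ξ : EuclideanSpace ℝ (Fin m)}
    (hξ : ∀ ζ : EuclideanSpace ℝ (Fin m), ‖ζ‖ ≤ δ * ‖ξ‖ → ξ + ζ ∈ Γ)
    (ζ : EuclideanSpace ℝ (Fin m)) :
    U (-ζ) * V (ξ + ζ) ≤ A * M * Real.exp (-min (k / 2) k₂ * (δ * ‖ξ‖) ^ (1 / σ))
      * Real.exp (-(k / 2) * ‖ζ‖ ^ (1 / σ)) := by
  have hA : 0 ≤ A := nonneg_of_mul_nonneg_left ((hU0 0).trans (hU 0)) (Real.exp_pos _)
  have hu := hU (-ζ)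
  rw [norm_neg] at hu
  have hsplit : Real.exp (-k * ‖ζ‖ ^ (1 / σ))
      = Real.exp (-(k / 2) * ‖ζ‖ ^ (1 / σ)) * Real.exp (-(k / 2) * ‖ζ‖ ^ (1 / σ)) := by
    rw [← Real.exp_add]; ring_nf
  have hσ' : 0 ≤ 1 / σ := by positivity
  have hk' : 0 ≤ min (k / 2) k₂ := by positivity
  rcases le_total ‖ζ‖ (δ * ‖ξ‖) with h | h
  · have hn : δ * ‖ξ‖ ≤ ‖ξ + ζ‖ := by
      have h1 := norm_sub_le_norm_add ξ ζ
      have h2 : δ * ‖ξ‖ ≤ 1 / 2 * ‖ξ‖ := by gcongr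
      linarith
    calc U (-ζ) * V (ξ + ζ)
        ≤ (A * Real.exp (-k * ‖ζ‖ ^ (1 / σ))) * (M * Real.exp (-k₂ * ‖ξ + ζ‖ ^ (1 / σ))) :=
          mul_le_mul hu (hVΓ _ (hξ ζ h)) (hV0 _) (by positivity)
      _ ≤ (A * Real.exp (-(k / 2) * ‖ζ‖ ^ (1 / σ)))
          * (M * Real.exp (-min (k / 2) k₂ * (δ * ‖ξ‖) ^ (1 / σ))) := by
          have hp : 0 ≤ ‖ζ‖ ^ (1 / σ) := by positivity
          have e1 : min (k / 2) k₂ * (δ * ‖ξ‖) ^ (1 / σ) ≤ k₂ * ‖ξ + ζ‖ ^ (1 / σ) := by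
            gcongr
            exact min_le_right _ _
          gcongr ?_ * Real.exp ?_ * (M * Real.exp ?_)
          · nlinarith
          · linarith
      _ = _ := by ring
  · calc U (-ζ) * V (ξ + ζ) ≤ (A * Real.exp (-k * ‖ζ‖ ^ (1 / σ))) * M :=
          mul_le_mul hu (hV _) (hV0 _) (by positivity)
      _ ≤ (A * (Real.exp (-min (k / 2) k₂ * (δ * ‖ξ‖) ^ (1 / σ))
          * Real.exp (-(k / 2) * ‖ζ‖ ^ (1 / σ)))) * M := by
          rw [hsplit]
          have e1 : min (k / 2) k₂ * (δ * ‖ξ‖) ^ (1 / σ) ≤ k / 2 * ‖ζ‖ ^ (1 / σ) := by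
            gcongr
            exact min_le_left _ _
          gcongr ?_ * (Real.exp ?_ * ?_) * M
          linarith
      _ = _ := by ring

/-! ### Leibniz formula and decay of the Fourier transform -/

section Smooth

variable {Ω : Opens (EuclideanSpace ℝ (Fin m))}

theorem pderiv_pow_mul (i : Fin m) (n : ℕ) (u v : SmoothFun Ω) :
    (pderiv i ^ n) (u * v) = ∑ p ∈ Finset.HasAntidiagonal.antidiagonal n,
      n.choose p.1 • ((pderiv i ^ p.1) u * (pderiv i ^ p.2) v) := by
  induction n with
  | zero => simp
  | succ n ih =>
    rw [Finset.sum_antidiagonal_choose_succ_nsmul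
      (fun k l => (pderiv i ^ k) u * (pderiv i ^ l) v) n]
    simp only [pow_succ', Module.End.mul_apply, ih, map_sum, map_nsmul, pderiv_mul, nsmul_add,
      Finset.sum_add_distrib]
    rw [add_comm]
    congr 1
    refine Finset.sum_congr rfl fun p hp => ?_
    rw [n.choose_symm_of_eq_add (Finset.HasAntidiagonal.mem_antidiagonal.1 hp).symm]

/-- In the Leibniz formula `p! q! ≤ n!` for `p + q = n`, so the factorials come out of the sum and
the binomial theorem leaves `(c + d)^n`. -/
theorem norm_pderiv_pow_mul_le {σ c d A B : ℝ} (hσ : 0 ≤ σ) (hc : 0 ≤ c) (hd : 0 ≤ d)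
    (hA : 0 ≤ A) (hB : 0 ≤ B) {i : Fin m} {u v : SmoothFun Ω} {x : Ω}
    (hu : ∀ n : ℕ, ‖((pderiv i ^ n) u : Ω → ℂ) x‖ ≤ A * c ^ n * (n.factorial : ℝ) ^ σ)
    (hv : ∀ n : ℕ, ‖((pderiv i ^ n) v : Ω → ℂ) x‖ ≤ B * d ^ n * (n.factorial : ℝ) ^ σ) (n : ℕ) :
    ‖((pderiv i ^ n) (u * v) : Ω → ℂ) x‖ ≤ A * B * (c + d) ^ n * (n.factorial : ℝ) ^ σ := by
  have key : ∀ p ∈ Finset.HasAntidiagonal.antidiagonal n,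
      ‖(n.choose p.1 : ℂ) * (((pderiv i ^ p.1) u : Ω → ℂ) x * ((pderiv i ^ p.2) v : Ω → ℂ) x)‖
        ≤ A * B * (n.factorial : ℝ) ^ σ * (n.choose p.1 • (c ^ p.1 * d ^ p.2)) := by
    intro p hp
    have hf : (p.1.factorial : ℝ) ^ σ * (p.2.factorial : ℝ) ^ σ ≤ (n.factorial : ℝ) ^ σ := by
      rw [← Real.mul_rpow (by positivity) (by positivity)]
      refine Real.rpow_le_rpow (by positivity) ?_ hσ
      have := Nat.le_of_dvd n.factorial_pos
        ((Finset.HasAntidiagonal.mem_antidiagonal.1 hp) ▸ Nat.factorial_mul_factorial_dvd_factorial_add p.1 p.2)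
      exact_mod_cast this
    rw [norm_mul, norm_mul, Complex.norm_natCast, nsmul_eq_mul]
    calc _ ≤ (n.choose p.1 : ℝ) * ((A * c ^ p.1 * (p.1.factorial : ℝ) ^ σ)
          * (B * d ^ p.2 * (p.2.factorial : ℝ) ^ σ)) := by
          gcongr
          · exact hu _
          · exact hv _
      _ = (n.choose p.1 : ℝ) * (A * B * (c ^ p.1 * d ^ p.2))
          * ((p.1.factorial : ℝ) ^ σ * (p.2.factorial : ℝ) ^ σ) := by ring
      _ ≤ (n.choose p.1 : ℝ) * (A * B * (c ^ p.1 * d ^ p.2)) * (n.factorial : ℝ) ^ σ := by gcongr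
      _ = _ := by ring
  have e : ((pderiv i ^ n) (u * v) : Ω → ℂ) x = ∑ p ∈ Finset.HasAntidiagonal.antidiagonal n,
      (n.choose p.1 : ℂ) * (((pderiv i ^ p.1) u : Ω → ℂ) x * ((pderiv i ^ p.2) v : Ω → ℂ) x) := by
    rw [pderiv_pow_mul]
    simp
  rw [e]
  refine (norm_sum_le_of_le _ key).trans_eq ?_
  rw [← Finset.mul_sum, ← (Commute.all c d).add_pow']
  ring

theorem hasCompactSupport_pderiv_pow {u : SmoothFun Ω} (hu : HasCompactSupport (u : Ω → ℂ))
    (i : Fin m) (n : ℕ) : HasCompactSupport ((pderiv i ^ n) u : Ω → ℂ) := by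
  rw [← mderiv_pi_single]
  exact hu.isCompact.of_isClosed_subset (isClosed_tsupport _) (tsupport_mderiv_subset u _)

theorem fourier_pderiv_pow {u : SmoothFun Ω} (hu : HasCompactSupport (u : Ω → ℂ)) (i : Fin m)
    (n : ℕ) (ξ : EuclideanSpace ℝ (Fin m)) :
    fourier ((pderiv i ^ n) u) ξ = (Complex.I * (ξ i : ℂ)) ^ n * fourier u ξ := by
  induction n with
  | zero => simp
  | succ n ih =>
    rw [pow_succ', Module.End.mul_apply, fourier_pderiv (hasCompactSupport_pderiv_pow hu i n), ih]
    ring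

theorem exists_norm_le_card_mul_abs (hm : 0 < m) (ξ : EuclideanSpace ℝ (Fin m)) :
    ∃ i, ‖ξ‖ ≤ m * |ξ i| := by
  have : Nonempty (Fin m) := ⟨⟨0, hm⟩⟩
  obtain ⟨i, hi⟩ := Finite.exists_max fun i => |ξ i|
  refine ⟨i, ?_⟩
  have hm1 : (1 : ℝ) ≤ m := by exact_mod_cast hm
  rw [EuclideanSpace.norm_eq]
  refine Real.sqrt_le_iff.2 ⟨by positivity, ?_⟩
  calc ∑ j, ‖ξ j‖ ^ 2 ≤ ∑ _j : Fin m, |ξ i| ^ 2 := by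
        gcongr with j
        exact hi j
    _ = m * |ξ i| ^ 2 := by simp
    _ ≤ m * (m * |ξ i| ^ 2) := le_mul_of_one_le_left (by positivity) hm1
    _ = (m * |ξ i|) ^ 2 := by ring

/-- Differentiating `n` times along the largest coordinate of `ξ` multiplies the transform by a
power comparable to `(‖ξ‖ / m)^n`, so pure derivatives suffice. The bounds for all `n` combine
through `le_exp_neg_of_gevrey_bound`. -/
theorem norm_fourier_le_of_gevrey_bound {σ c M : ℝ} (hσ : 0 < σ) (hc : 0 < c) (hM : 0 ≤ M)
    (hm : 0 < m) {u : SmoothFun Ω} {K : Set Ω} (hK : IsCompact K)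
    (hu : tsupport (u : Ω → ℂ) ⊆ K)
    (h : ∀ i, ∀ n : ℕ, ∀ x ∈ K,
      ‖((pderiv i ^ n) u : Ω → ℂ) x‖ ≤ M * c ^ n * (n.factorial : ℝ) ^ σ)
    (ξ : EuclideanSpace ℝ (Fin m)) :
    ‖fourier u ξ‖ ≤ 2 ^ σ * (M * volume.real (Subtype.val '' K))
      * Real.exp (-(σ / 2) * (‖ξ‖ / (m * c)) ^ (1 / σ)) := by
  have hcu : HasCompactSupport (u : Ω → ℂ) := hK.of_isClosed_subset (isClosed_tsupport _) hu
  have hm' : (0 : ℝ) < m := by exact_mod_cast hm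
  obtain ⟨i, hi⟩ := exists_norm_le_card_mul_abs hm ξ
  refine le_exp_neg_of_gevrey_bound hσ (norm_nonneg _) (by positivity) (by positivity) fun n => ?_
  have h1 := norm_fourier_le (u := (pderiv i ^ n) u) hK
    (by rw [← mderiv_pi_single]; exact (tsupport_mderiv_subset u _).trans hu) (h i n) ξ
  rw [fourier_pderiv_pow hcu, norm_mul, norm_pow, norm_mul, Complex.norm_I, one_mul,
    Complex.norm_real, Real.norm_eq_abs] at h1
  calc (‖ξ‖ / (m * c)) ^ n * ‖fourier u ξ‖ ≤ (|ξ i| / c) ^ n * ‖fourier u ξ‖ := by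
        have h2 : ‖ξ‖ / (m * c) ≤ |ξ i| / c := by
          rw [div_le_div_iff₀ (by positivity) hc]
          nlinarith
        gcongr
    _ = |ξ i| ^ n * ‖fourier u ξ‖ / c ^ n := by rw [div_pow]; ring
    _ ≤ M * c ^ n * (n.factorial : ℝ) ^ σ * volume.real (Subtype.val '' K) / c ^ n := by gcongr
    _ = _ := by field_simp

end Smooth

variable {Ω : Opens (EuclideanSpace ℝ (Fin m))} {σ : ℝ}

/-! ### Shrinking Gevrey cutoff functions -/

theorem hasCompactSupport_mderiv {u : SmoothFun Ω} (hu : HasCompactSupport (u : Ω → ℂ))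
    (α : Fin m → ℕ) : HasCompactSupport (mderiv α u : Ω → ℂ) :=
  hu.isCompact.of_isClosed_subset (isClosed_tsupport _) (tsupport_mderiv_subset u α)

/-- The function `x ↦ u (x₀ + t (x - x₀))` for a compactly supported `u`. -/
noncomputable def dilate (x₀ : EuclideanSpace ℝ (Fin m)) (t : ℝ) (u : SmoothFun Ω)
    (hu : HasCompactSupport (u : Ω → ℂ)) : SmoothFun Ω :=
  ⟨fun x => zeroExt (u : Ω → ℂ) (x₀ + t • ((x : EuclideanSpace ℝ (Fin m)) - x₀)), by
    have h : ContDiff ℝ ∞ fun x : EuclideanSpace ℝ (Fin m) =>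
        zeroExt (u : Ω → ℂ) (x₀ + t • (x - x₀)) :=
      (contDiff_zeroExt hu).comp (by fun_prop)
    exact h.contDiffOn.congr fun x hx => zeroExt_of_mem _ (SetLike.mem_coe.1 hx)⟩

theorem dilate_apply (x₀ : EuclideanSpace ℝ (Fin m)) (t : ℝ) (u : SmoothFun Ω)
    (hu : HasCompactSupport (u : Ω → ℂ)) (x : Ω) :
    (dilate x₀ t u hu : Ω → ℂ) x
      = zeroExt (u : Ω → ℂ) (x₀ + t • ((x : EuclideanSpace ℝ (Fin m)) - x₀)) := rfl

theorem pderiv_dilate (x₀ : EuclideanSpace ℝ (Fin m)) (t : ℝ) (u : SmoothFun Ω)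
    (hu : HasCompactSupport (u : Ω → ℂ)) (hu' : ∀ i, HasCompactSupport (pderiv i u : Ω → ℂ))
    (i : Fin m) :
    pderiv i (dilate x₀ t u hu) = (t : ℂ) • dilate x₀ t (pderiv i u) (hu' i) := by
  ext x
  have h : zeroExt (dilate x₀ t u hu : Ω → ℂ) =ᶠ[𝓝 (x : EuclideanSpace ℝ (Fin m))]
      fun y => zeroExt (u : Ω → ℂ) (x₀ + t • (y - x₀)) :=
    eventuallyEq_zeroExt (fun y => by rw [zeroExt_coe, dilate_apply]) x
  have hd : HasFDerivAt (fun y : EuclideanSpace ℝ (Fin m) => x₀ + t • (y - x₀))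
      (t • ContinuousLinearMap.id ℝ (EuclideanSpace ℝ (Fin m)))
      (x : EuclideanSpace ℝ (Fin m)) :=
    (((hasFDerivAt_id (𝕜 := ℝ) _).sub_const x₀).const_smul t).const_add x₀
  have hz := ((contDiff_zeroExt hu).differentiable (by simp)
    (x₀ + t • ((x : EuclideanSpace ℝ (Fin m)) - x₀))).hasFDerivAt
  have hcomp : fderiv ℝ (fun y => zeroExt (u : Ω → ℂ) (x₀ + t • (y - x₀)))
      (x : EuclideanSpace ℝ (Fin m)) = _ :=
    (hz.comp (x : EuclideanSpace ℝ (Fin m)) hd).fderiv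
  rw [pderiv_apply, h.fderiv_eq, hcomp]
  change _ = (t : ℂ) * zeroExt (pderiv i u : Ω → ℂ) _
  rw [zeroExt_pderiv hu]
  simp

theorem mderiv_dilate (x₀ : EuclideanSpace ℝ (Fin m)) (t : ℝ) (u : SmoothFun Ω)
    (hu : HasCompactSupport (u : Ω → ℂ)) (α : Fin m → ℕ) :
    mderiv α (dilate x₀ t u hu)
      = ((t : ℂ) ^ (∑ i, α i)) • dilate x₀ t (mderiv α u) (hasCompactSupport_mderiv hu α) := by
  induction α using multiIndex_induction with
  | zero => simp [mderiv_zero]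
  | add_single α i ih =>
    rw [mderiv_add_single', ih, map_smul, pderiv_dilate _ _ _ _ fun i => by
      have := hasCompactSupport_mderiv hu (α + Pi.single i 1)
      rwa [mderiv_add_single'] at this]
    rw [smul_smul, ← pow_succ]
    simp only [mderiv_add_single', Pi.add_apply, Finset.sum_add_distrib, Finset.sum_pi_single',
      Finset.mem_univ, if_true]

theorem tsupport_dilate_subset {x₀ : EuclideanSpace ℝ (Fin m)} {t R : ℝ} (ht : 0 < t)
    {u : SmoothFun Ω} (hu : HasCompactSupport (u : Ω → ℂ))
    (hR : Subtype.val '' tsupport (u : Ω → ℂ) ⊆ Metric.closedBall x₀ R) :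
    tsupport (dilate x₀ t u hu : Ω → ℂ) ⊆ Subtype.val ⁻¹' Metric.closedBall x₀ (R / t) := by
  refine closure_minimal (fun x hx => ?_)
    (Metric.isClosed_closedBall.preimage continuous_subtype_val)
  have h : x₀ + t • ((x : EuclideanSpace ℝ (Fin m)) - x₀) ∈ Metric.closedBall x₀ R := by
    refine hR ?_
    by_contra h
    exact hx (zeroExt_eq_zero _ h)
  rw [mem_closedBall_iff_norm, add_sub_cancel_left, norm_smul, Real.norm_of_nonneg ht.le] at h
  rw [mem_preimage, mem_closedBall_iff_norm, le_div_iff₀ ht]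
  linarith

/-- The chain rule contributes `t^{|α|}`, absorbed by replacing `c` with `t * c`. Bounds for `u` on
its own support are enough, since its derivatives vanish elsewhere. -/
theorem IsGevrey.dilate {x₀ : EuclideanSpace ℝ (Fin m)} {t : ℝ} (ht : 1 ≤ t)
    {u : SmoothFun Ω} (hu : HasCompactSupport (u : Ω → ℂ)) (h : IsGevrey σ u) :
    IsGevrey σ (GenGevrey.dilate x₀ t u hu) := by
  intro K _
  obtain ⟨c, hc, hb⟩ := h _ hu.isCompact
  refine ⟨t * c, by positivity, fun α x _ => ?_⟩
  rw [mderiv_dilate]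
  change ‖(t : ℂ) ^ (∑ i, α i) * zeroExt (mderiv α u : Ω → ℂ) _‖ ≤ _
  set y := x₀ + t • ((x : EuclideanSpace ℝ (Fin m)) - x₀) with hy
  have h1 : ‖zeroExt (mderiv α u : Ω → ℂ) y‖
      ≤ c ^ ((∑ i, α i) + 1) * ((∏ i, (α i).factorial : ℕ) : ℝ) ^ σ := by
    by_cases hyK : y ∈ Subtype.val '' tsupport (mderiv α u : Ω → ℂ)
    · obtain ⟨z, hz, hzy⟩ := hyK
      rw [← hzy, zeroExt_coe]
      exact hb α z (tsupport_mderiv_subset u α hz)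
    · rw [zeroExt_eq_zero _ hyK, norm_zero]
      positivity
  rw [norm_mul, norm_pow, Complex.norm_real, Real.norm_of_nonneg (by linarith), mul_pow]
  calc _ ≤ t ^ ((∑ i, α i) + 1)
        * (c ^ ((∑ i, α i) + 1) * ((∏ i, (α i).factorial : ℕ) : ℝ) ^ σ) := by
        gcongr
        omega
    _ = _ := by ring

/-- Contracting `φ` itself towards `x₀` yields the smaller cutoff, so no Gevrey bump function has to
be constructed. -/
theorem exists_gevreyTest_shrink {φ : SmoothFun Ω} (hφ : φ ∈ GevreyTest σ Ω) {x₀ : Ω}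
    (h1 : ∀ᶠ x in 𝓝 x₀, (φ : Ω → ℂ) x = 1) :
    ∃ ψ ∈ GevreyTest σ Ω, (∀ᶠ x in 𝓝 x₀, (ψ : Ω → ℂ) x = 1) ∧
      ∀ x ∈ tsupport (ψ : Ω → ℂ), ∀ᶠ y in 𝓝 x, (φ : Ω → ℂ) y = 1 := by
  obtain ⟨hG, hc⟩ := hφ
  have h2 : ∀ᶠ y : EuclideanSpace ℝ (Fin m) in 𝓝 (x₀ : EuclideanSpace ℝ (Fin m)),
      ∃ h : y ∈ Ω, (φ : Ω → ℂ) ⟨y, h⟩ = 1 := by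
    rw [← map_nhds_subtype_val (s := (Ω : Set (EuclideanSpace ℝ (Fin m)))) x₀ |>.trans
      (Ω.isOpen.nhdsWithin_eq x₀.2), eventually_map]
    filter_upwards [h1] with y hy using ⟨y.2, hy⟩
  obtain ⟨r, hr, hball⟩ := Metric.eventually_nhds_iff_ball.1 h2
  obtain ⟨R, hR, hKR⟩ := (hc.isCompact.image continuous_subtype_val).isBounded.subset_closedBall_lt
    0 (x₀ : EuclideanSpace ℝ (Fin m))
  -- Chosen so that `R / t = R r / (r + R) < r`: the support shrinks from radius `R` into the ball
  -- where `φ = 1`.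
  set t := 1 + R / r with ht
  have ht1 : 1 ≤ t := by
    have : 0 < R / r := by positivity
    linarith
  have ht0 : 0 < t := by linarith
  have hRt : R / t < r := by
    rw [div_lt_iff₀ ht0, ht, mul_add, mul_one, mul_div_cancel₀ _ hr.ne']
    linarith
  have hsub := tsupport_dilate_subset ht0 hc hKR
  have hcs : HasCompactSupport (dilate x₀ t φ hc : Ω → ℂ) := by
    refine IsCompact.of_isClosed_subset (?_ : IsCompact (Subtype.val ⁻¹'
      Metric.closedBall (x₀ : EuclideanSpace ℝ (Fin m)) (R / t))) (isClosed_tsupport _) hsub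
    refine IsInducing.subtypeVal.isCompact_preimage' (isCompact_closedBall _ _) ?_
    rw [Subtype.range_coe]
    exact fun y hy => (hball y (Metric.closedBall_subset_ball hRt hy)).1
  refine ⟨dilate x₀ t φ hc, ⟨hG.dilate ht1 hc, hcs⟩, ?_, fun x hx => ?_⟩
  · have hcont : Continuous fun x : Ω => (x₀ : EuclideanSpace ℝ (Fin m))
        + t • ((x : EuclideanSpace ℝ (Fin m)) - x₀) := by fun_prop
    have h3 := hcont.tendsto x₀
    simp only [sub_self, smul_zero, add_zero] at h3
    filter_upwards [h3.eventually h2] with x hx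
    obtain ⟨h, hx⟩ := hx
    rw [dilate_apply, zeroExt_of_mem _ h, hx]
  · have hx' : (x : EuclideanSpace ℝ (Fin m)) ∈ Metric.ball (x₀ : EuclideanSpace ℝ (Fin m)) r :=
      Metric.closedBall_subset_ball hRt (hsub hx)
    filter_upwards [continuous_subtype_val.continuousAt.eventually
      (Metric.isOpen_ball.mem_nhds hx')] with y hy
    exact (hball _ hy).2

theorem mul_mderiv_mul_of_eventually_eq_one {φ ψ : SmoothFun Ω}
    (h : ∀ x ∈ tsupport (ψ : Ω → ℂ), ∀ᶠ y in 𝓝 x, (φ : Ω → ℂ) y = 1) (α : Fin m → ℕ)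
    (u : SmoothFun Ω) : ψ * mderiv α (φ * u) = ψ * mderiv α u := by
  ext x
  change (ψ : Ω → ℂ) x * (mderiv α (φ * u) : Ω → ℂ) x = (ψ : Ω → ℂ) x * (mderiv α u : Ω → ℂ) x
  by_cases hx : x ∈ tsupport (ψ : Ω → ℂ)
  · have : ((φ * u : SmoothFun Ω) : Ω → ℂ) =ᶠ[𝓝 x] u := by
      filter_upwards [h x hx] with y hy
      change (φ : Ω → ℂ) y * (u : Ω → ℂ) y = _
      rw [hy, one_mul]
    rw [(mderiv_eventuallyEq this α).eq_of_nhds]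
  · rw [image_eq_zero_of_notMem_tsupport hx, zero_mul, zero_mul]

/-! ### Nets with exponentially decaying Fourier transforms -/

/-- The Fourier transforms of the net decay on `Γ`, as in the definition of `singCone`. -/
def DecaysOn (σ : ℝ) (Γ : Set (EuclideanSpace ℝ (Fin m))) (f : Net Ω) : Prop :=
  ∃ k₁ > (0 : ℝ), ∃ k₂ > (0 : ℝ), ∃ c > (0 : ℝ), ∃ ε₀ : Ioc (0 : ℝ) 1, ∀ ξ ∈ Γ, ∀ ε ≤ ε₀,
    ‖fourier (f ε) ξ‖ ≤ c * Real.exp (k₁ * weight σ ε - k₂ * ‖ξ‖ ^ (1 / σ))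

theorem fourier_zero (ξ : EuclideanSpace ℝ (Fin m)) : fourier (0 : SmoothFun Ω) ξ = 0 := by
  have : zeroExt ((0 : SmoothFun Ω) : Ω → ℂ) = 0 := by
    ext x
    exact zeroExt_eq_zero _ (by simp [tsupport])
  rw [fourier, this]
  simp

theorem integrable_fourier_integrand {u : SmoothFun Ω} (hu : HasCompactSupport (u : Ω → ℂ))
    (ξ : EuclideanSpace ℝ (Fin m)) :
    Integrable fun x : EuclideanSpace ℝ (Fin m) =>
      Complex.exp (-Complex.I * ((inner ℝ x ξ : ℝ) : ℂ)) * zeroExt (u : Ω → ℂ) x :=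
  (Continuous.mul (by fun_prop) (contDiff_zeroExt hu).continuous).integrable_of_hasCompactSupport
    (hasCompactSupport_zeroExt hu).mul_left

theorem fourier_add {u v : SmoothFun Ω} (hu : HasCompactSupport (u : Ω → ℂ))
    (hv : HasCompactSupport (v : Ω → ℂ)) (ξ : EuclideanSpace ℝ (Fin m)) :
    fourier (u + v) ξ = fourier u ξ + fourier v ξ := by
  rw [fourier, fourier, fourier,
    ← integral_add (integrable_fourier_integrand hu ξ) (integrable_fourier_integrand hv ξ)]
  congr 1
  ext x
  rw [← mul_add]
  congr 1
  by_cases h : x ∈ Ω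
  · simp [zeroExt_of_mem _ h]
  · simp [zeroExt_of_notMem _ h]

theorem fourier_const_smul (z : ℂ) (u : SmoothFun Ω) (ξ : EuclideanSpace ℝ (Fin m)) :
    fourier (z • u) ξ = z * fourier u ξ := by
  rw [fourier, fourier, ← integral_const_mul]
  congr 1
  ext x
  rw [mul_left_comm]
  congr 1
  by_cases h : x ∈ Ω
  · simp [zeroExt_of_mem _ h]
  · simp [zeroExt_of_notMem _ h]

theorem DecaysOn.zero (Γ : Set (EuclideanSpace ℝ (Fin m))) : DecaysOn σ Γ (0 : Net Ω) :=
  ⟨1, one_pos, 1, one_pos, 1, one_pos, ⟨1, by simp⟩, fun ξ _ ε _ => by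
    rw [Pi.zero_apply, fourier_zero, norm_zero]
    positivity⟩

theorem DecaysOn.add {Γ : Set (EuclideanSpace ℝ (Fin m))} {f g : Net Ω}
    (hf : DecaysOn σ Γ f) (hg : DecaysOn σ Γ g) (hfc : ∀ ε, HasCompactSupport (f ε : Ω → ℂ))
    (hgc : ∀ ε, HasCompactSupport (g ε : Ω → ℂ)) : DecaysOn σ Γ (f + g) := by
  obtain ⟨k₁, hk₁, k₂, hk₂, c, hc, e, h⟩ := hf
  obtain ⟨l₁, hl₁, l₂, hl₂, d, hd, e', h'⟩ := hg
  refine ⟨max k₁ l₁, by positivity, min k₂ l₂, by positivity, c + d, by positivity, min e e',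
    fun ξ hξ ε hε => ?_⟩
  have w := weight_nonneg σ ε
  have p : 0 ≤ ‖ξ‖ ^ (1 / σ) := by positivity
  have a₁ : k₁ * weight σ ε ≤ max k₁ l₁ * weight σ ε := by gcongr; exact le_max_left _ _
  have a₂ : l₁ * weight σ ε ≤ max k₁ l₁ * weight σ ε := by gcongr; exact le_max_right _ _
  have b₁ : min k₂ l₂ * ‖ξ‖ ^ (1 / σ) ≤ k₂ * ‖ξ‖ ^ (1 / σ) := by gcongr; exact min_le_left _ _
  have b₂ : min k₂ l₂ * ‖ξ‖ ^ (1 / σ) ≤ l₂ * ‖ξ‖ ^ (1 / σ) := by gcongr; exact min_le_right _ _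
  rw [Pi.add_apply, fourier_add (hfc ε) (hgc ε), add_mul]
  refine (norm_add_le _ _).trans (add_le_add ?_ ?_)
  · refine (h ξ hξ ε (hε.trans (min_le_left _ _))).trans ?_
    gcongr
  · refine (h' ξ hξ ε (hε.trans (min_le_right _ _))).trans ?_
    gcongr

/-- The support statement is carried through the induction because additivity of the Fourier
integral uses compact supports. -/
theorem DecaysOn.sum {ι : Type*} {Γ : Set (EuclideanSpace ℝ (Fin m))} (s : Finset ι)
    {f : ι → Net Ω} {K : Set Ω} (hK : IsCompact K) (hf : ∀ i ∈ s, DecaysOn σ Γ (f i))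
    (hfK : ∀ i ∈ s, ∀ ε, tsupport (f i ε : Ω → ℂ) ⊆ K) :
    DecaysOn σ Γ (∑ i ∈ s, f i) ∧ ∀ ε, tsupport ((∑ i ∈ s, f i) ε : Ω → ℂ) ⊆ K := by
  refine Finset.sum_induction f (fun g => DecaysOn σ Γ g ∧ ∀ ε, tsupport (g ε : Ω → ℂ) ⊆ K)
    (fun g h hg hh => ⟨hg.1.add hh.1 (fun ε => ?_) fun ε => ?_, fun ε => ?_⟩)
    ⟨DecaysOn.zero Γ, fun ε => by simp [tsupport]⟩ fun i hi => ⟨hf i hi, hfK i hi⟩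
  · exact hK.of_isClosed_subset (isClosed_tsupport _) (hg.2 ε)
  · exact hK.of_isClosed_subset (isClosed_tsupport _) (hh.2 ε)
  · exact (tsupport_add (g ε : Ω → ℂ) (h ε : Ω → ℂ)).trans (union_subset (hg.2 ε) (hh.2 ε))

theorem DecaysOn.const_smul {Γ : Set (EuclideanSpace ℝ (Fin m))} {f : Net Ω}
    (hf : DecaysOn σ Γ f) (z : ℂ) : DecaysOn σ Γ (z • f) := by
  obtain ⟨k₁, hk₁, k₂, hk₂, c, hc, e, h⟩ := hf
  refine ⟨k₁, hk₁, k₂, hk₂, (‖z‖ + 1) * c, by positivity, e, fun ξ hξ ε hε => ?_⟩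
  rw [Pi.smul_apply, fourier_const_smul, norm_mul, mul_assoc]
  gcongr
  · linarith
  · exact h ξ hξ ε hε

theorem DecaysOn.pderiv (hσ : 0 < σ) {Γ : Set (EuclideanSpace ℝ (Fin m))} {f : Net Ω}
    (hf : DecaysOn σ Γ f) (hfc : ∀ ε, HasCompactSupport (f ε : Ω → ℂ)) (i : Fin m) :
    DecaysOn σ Γ fun ε => pderiv i (f ε) := by
  obtain ⟨k₁, hk₁, k₂, hk₂, c, hc, e, h⟩ := hf
  -- The factor `ξ i` is absorbed by giving up half of the decay rate `k₂`.
  obtain ⟨C, hC, hb⟩ := exists_one_add_pow_le_exp hσ (half_pos hk₂) 1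
  refine ⟨k₁, hk₁, k₂ / 2, by positivity, C * c, by positivity, e, fun ξ hξ ε hε => ?_⟩
  rw [fourier_pderiv (hfc ε), norm_mul, norm_mul, Complex.norm_I, one_mul, Complex.norm_real]
  have h1 : ‖ξ i‖ ≤ C * Real.exp (k₂ / 2 * ‖ξ‖ ^ (1 / σ)) := by
    have h2 := hb ‖ξ‖ (norm_nonneg _)
    have h3 := PiLp.norm_apply_le ξ i
    linarith
  calc _ ≤ (C * Real.exp (k₂ / 2 * ‖ξ‖ ^ (1 / σ)))
        * (c * Real.exp (k₁ * weight σ ε - k₂ * ‖ξ‖ ^ (1 / σ))) :=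
        mul_le_mul h1 (h ξ hξ ε hε) (norm_nonneg _) (by positivity)
    _ = C * c * (Real.exp (k₂ / 2 * ‖ξ‖ ^ (1 / σ))
        * Real.exp (k₁ * weight σ ε - k₂ * ‖ξ‖ ^ (1 / σ))) := by ring
    _ = _ := by rw [← Real.exp_add]; ring_nf

theorem DecaysOn.mderiv (hσ : 0 < σ) {Γ : Set (EuclideanSpace ℝ (Fin m))} {f : Net Ω}
    (hf : DecaysOn σ Γ f) (hfc : ∀ ε, HasCompactSupport (f ε : Ω → ℂ)) (α : Fin m → ℕ) :
    DecaysOn σ Γ fun ε => mderiv α (f ε) := by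
  induction α using multiIndex_induction with
  | zero => simpa only [mderiv_zero, Module.End.one_apply] using hf
  | add_single α i ih =>
    simpa only [mderiv_add_single'] using
      ih.pderiv hσ (fun ε => hasCompactSupport_mderiv (hfc ε) α) i

theorem ModerateBound.exists_norm_fourier_le {f : Net Ω} (hf : ModerateBound σ f) {K : Set Ω}
    (hK : IsCompact K) (hfK : ∀ ε, tsupport (f ε : Ω → ℂ) ⊆ K) :
    ∃ k > (0 : ℝ), ∃ c > (0 : ℝ), ∃ ε₀ : Ioc (0 : ℝ) 1, ∀ ε ≤ ε₀, ∀ ξ,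
      ‖fourier (f ε) ξ‖ ≤ c * Real.exp (k * weight σ ε) := by
  obtain ⟨k, hk, c, hc, e, h⟩ := hf K hK
  refine ⟨k, hk, c * (volume.real (Subtype.val '' K) + 1), by positivity, e, fun ε hε ξ => ?_⟩
  refine (norm_fourier_le hK (hfK ε) (h ε hε) ξ).trans ?_
  rw [mul_right_comm]
  gcongr
  linarith

/-- Gevrey bounds on the iterated partial derivatives of a net on `K`. -/
def DirectionalGevreyBound (σ : ℝ) (K : Set Ω) (b : Net Ω) : Prop :=
  ∃ k > (0 : ℝ), ∃ c > (0 : ℝ), ∃ M > (0 : ℝ), ∃ ε₀ : Ioc (0 : ℝ) 1, ∀ ε ≤ ε₀, ∀ i, ∀ n : ℕ,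
    ∀ x ∈ K, ‖((GenGevrey.pderiv i ^ n) (b ε) : Ω → ℂ) x‖
      ≤ M * Real.exp (k * weight σ ε) * c ^ n * (n.factorial : ℝ) ^ σ

theorem IsRegular.directionalGevreyBound_mul (hσ : 0 ≤ σ) {φ : SmoothFun Ω} (hφ : IsGevrey σ φ)
    {f : Net Ω} (hf : IsRegular σ f) {K : Set Ω} (hK : IsCompact K) :
    DirectionalGevreyBound σ K fun ε => φ * f ε := by
  obtain ⟨c, hc, h⟩ := hφ K hK
  obtain ⟨k, hk, d, hd, e, h'⟩ := hf K hK
  refine ⟨k, hk, c + d, by positivity, c * d, by positivity, e, fun ε hε i n x hx => ?_⟩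
  have hsum : ∀ n : ℕ, ∑ j, (Pi.single i n : Fin m → ℕ) j = n := fun n => by simp
  have hprod : ∀ n : ℕ, ∏ j, ((Pi.single i n : Fin m → ℕ) j).factorial = n.factorial := fun n => by
    rw [Finset.prod_eq_single i (fun j _ hj => by simp [hj]) (by simp)]
    simp
  refine (norm_pderiv_pow_mul_le (A := c) (B := d * Real.exp (k * weight σ ε)) hσ hc.le hd.le
    hc.le (by positivity) (fun n => ?_) (fun n => ?_) n).trans_eq (by ring)
  · have := h (Pi.single i n) x hx
    rw [mderiv_pi_single, hsum, hprod] at this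
    exact this.trans_eq (by ring)
  · have := h' (Pi.single i n) ε hε x hx
    rw [mderiv_pi_single, hsum, hprod] at this
    exact this.trans_eq (by ring)

/-- Multiplication by a Gevrey regular net preserves decay, after shrinking the cone. This is where
regularity of the coefficients matters: their transforms must decay in all directions, at a rate
independent of `ε`. -/
theorem DecaysOn.mul (hσ : 0 < σ) (hm : 0 < m) {Γ Γ' : Set (EuclideanSpace ℝ (Fin m))} {δ : ℝ}
    (hδ : 0 < δ) (hδ' : δ ≤ 1 / 2)
    (hΓ : ∀ ξ ∈ Γ', ∀ ζ : EuclideanSpace ℝ (Fin m), ‖ζ‖ ≤ δ * ‖ξ‖ → ξ + ζ ∈ Γ)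
    {b g : Net Ω} {K L : Set Ω} (hK : IsCompact K) (hL : IsCompact L)
    (hbK : ∀ ε, tsupport (b ε : Ω → ℂ) ⊆ K) (hgL : ∀ ε, tsupport (g ε : Ω → ℂ) ⊆ L)
    (hb : DirectionalGevreyBound σ K b) (hg : ModerateBound σ g) (hgΓ : DecaysOn σ Γ g) :
    DecaysOn σ Γ' fun ε => b ε * g ε := by
  obtain ⟨kb, hkb, cb, hcb, Mb, hMb, eb, hb⟩ := hb
  obtain ⟨kg, hkg, cg, hcg, eg, hg⟩ := hg.exists_norm_fourier_le hL hgL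
  obtain ⟨k₁, hk₁, k₂, hk₂, c, hc, e, h⟩ := hgΓ
  have hm' : (0 : ℝ) < m := by exact_mod_cast hm
  -- The decay rate given by `norm_fourier_le_of_gevrey_bound`, with the scale `m * cb` pulled out
  -- of the power.
  set k := σ / 2 * (1 / (m * cb)) ^ (1 / σ) with hk
  have hk0 : 0 < k := by positivity
  set vol := volume.real (Subtype.val '' K) with hvol
  set A := 2 ^ σ * (Mb * vol) with hA
  have hA0 : 0 ≤ A := by positivity
  set J := ∫ t : EuclideanSpace ℝ (Fin m),
    Real.exp (-(k / 2) * ‖(2 * Real.pi) • t‖ ^ (1 / σ)) with hJ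
  have hJint : Integrable fun t : EuclideanSpace ℝ (Fin m) =>
      Real.exp (-(k / 2) * ‖(2 * Real.pi) • t‖ ^ (1 / σ)) :=
    (integrable_exp_neg_norm_rpow volume hσ (half_pos hk0)).comp_smul (by positivity)
  have hJ0 : 0 ≤ J := integral_nonneg fun _ => (Real.exp_pos _).le
  refine ⟨kb + (kg + k₁), by positivity, min (k / 2) k₂ * δ ^ (1 / σ), by positivity,
    A * (cg + c) * J + 1, by positivity, min eb (min eg e), fun ξ hξ ε hε => ?_⟩
  have hεb := hε.trans (min_le_left _ _)
  have hεg := hε.trans ((min_le_right _ _).trans (min_le_left _ _))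
  have hεe := hε.trans ((min_le_right _ _).trans (min_le_right _ _))
  have w := weight_nonneg σ ε
  -- One constant dominating both the global moderate bound and the bound on `Γ`, as
  -- `mul_le_exp_of_cone` requires.
  set M := (cg + c) * Real.exp ((kg + k₁) * weight σ ε) with hM
  have hU : ∀ ζ, ‖fourier (b ε) ζ‖
      ≤ A * Real.exp (kb * weight σ ε) * Real.exp (-k * ‖ζ‖ ^ (1 / σ)) := fun ζ => by
    refine (norm_fourier_le_of_gevrey_bound hσ hcb (by positivity) hm hK (hbK ε)
      (hb ε hεb) ζ).trans_eq ?_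
    rw [div_eq_mul_one_div ‖ζ‖, Real.mul_rpow (norm_nonneg _) (by positivity), hA, hk, ← hvol]
    ring_nf
  have hV : ∀ η, ‖fourier (g ε) η‖ ≤ M := fun η => by
    refine (hg ε hεg η).trans ?_
    rw [hM]
    gcongr <;> linarith
  have hVΓ : ∀ η ∈ Γ, ‖fourier (g ε) η‖ ≤ M * Real.exp (-k₂ * ‖η‖ ^ (1 / σ)) := fun η hη => by
    refine (h η hη ε hεe).trans ?_
    rw [hM, sub_eq_add_neg, Real.exp_add, neg_mul, ← mul_assoc]
    gcongr <;> linarith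
  calc ‖fourier (b ε * g ε) ξ‖
      ≤ ∫ t, ‖fourier (b ε) (-((2 * Real.pi) • t))‖
          * ‖fourier (g ε) (ξ + (2 * Real.pi) • t)‖ :=
        norm_fourier_mul_le (hK.of_isClosed_subset (isClosed_tsupport _) (hbK ε))
          (hL.of_isClosed_subset (isClosed_tsupport _) (hgL ε)) ξ
    _ ≤ ∫ t : EuclideanSpace ℝ (Fin m), A * Real.exp (kb * weight σ ε) * M
          * Real.exp (-min (k / 2) k₂ * (δ * ‖ξ‖) ^ (1 / σ))
          * Real.exp (-(k / 2) * ‖(2 * Real.pi) • t‖ ^ (1 / σ)) := by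
        refine integral_mono_of_nonneg (Eventually.of_forall fun t => by positivity)
          (hJint.const_mul _) (Eventually.of_forall fun t => ?_)
        exact mul_le_exp_of_cone hσ hk0 hk₂ (by positivity) hδ hδ' (fun _ => norm_nonneg _) hU
          (fun _ => norm_nonneg _) hV hVΓ (hΓ ξ hξ) _
    _ = A * (cg + c) * J * Real.exp ((kb + (kg + k₁)) * weight σ ε
          - min (k / 2) k₂ * δ ^ (1 / σ) * ‖ξ‖ ^ (1 / σ)) := by
        rw [integral_const_mul, ← hJ, hM, Real.mul_rpow hδ.le (norm_nonneg _), sub_eq_add_neg,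
          Real.exp_add, add_mul kb, Real.exp_add]
        ring_nf
    _ ≤ _ := by
        gcongr
        linarith

/-! ### The wave front of `P(x,D) f` -/

theorem cl_mul (f g : Moderate σ Ω) : cl (f * g) = cl f * cl g := rfl

theorem cl_smul (z : ℂ) (f : Moderate σ Ω) : cl (z • f) = z • cl f := rfl

theorem cl_sum {ι : Type*} (s : Finset ι) (f : ι → Moderate σ Ω) :
    cl (∑ i ∈ s, f i) = ∑ i ∈ s, cl (f i) :=
  map_sum (Ideal.Quotient.mk (Null σ Ω)) f s

/-- The two sides agree exactly, for every `ε`, on a representative of `f`, so no null net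
intervenes. -/
theorem ofSmooth_mul_gderiv {φ ψ : SmoothFun Ω}
    (h : ∀ x ∈ tsupport (ψ : Ω → ℂ), ∀ᶠ y in 𝓝 x, (φ : Ω → ℂ) y = 1) (α : Fin m → ℕ)
    (f : G σ Ω) :
    ofSmooth σ ψ * gderiv α (ofSmooth σ φ * f) = ofSmooth σ ψ * gderiv α f := by
  obtain ⟨F, rfl⟩ : ∃ F : Moderate σ Ω, cl F = f := Ideal.Quotient.mk_surjective f
  rw [ofSmooth, ofSmooth, ← cl_mul, gderiv_cl, gderiv_cl, ← cl_mul, ← cl_mul]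
  congr 1
  refine Subtype.ext (funext fun ε => ?_)
  exact mul_mderiv_mul_of_eventually_eq_one h α ((F : Net Ω) ε)

theorem notMem_singCone_iff {u : G σ Ω} {ξ₀ : EuclideanSpace ℝ (Fin m)} (h0 : ξ₀ ≠ 0) :
    ξ₀ ∉ singCone u ↔ ∃ Γ : Set (EuclideanSpace ℝ (Fin m)), IsConicNhd Γ ξ₀ ∧
      ∃ f : Moderate σ Ω, cl f = u ∧
        (∃ K : Set Ω, IsCompact K ∧ ∀ ε, tsupport ((f : Net Ω) ε : Ω → ℂ) ⊆ K) ∧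
        DecaysOn σ Γ (f : Net Ω) := by
  rw [singCone, mem_ofPred_eq, not_and, not_not]
  exact ⟨fun h => h h0, fun h _ => h⟩

theorem tsupport_mul_subset_of_left {u v : SmoothFun Ω} {K : Set Ω}
    (h : tsupport (u : Ω → ℂ) ⊆ K) : tsupport ((u * v : SmoothFun Ω) : Ω → ℂ) ⊆ K :=
  (tsupport_mul_subset_left (f := (u : Ω → ℂ)) (g := (v : Ω → ℂ))).trans h

theorem notMem_singCone_ofSmooth_mul_diffOp (hσ : 0 < σ) {N : ℕ} {a : (Fin m → ℕ) → G σ Ω}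
    (ha : ∀ α : Fin m → ℕ, ∑ i, α i ≤ N → a α ∈ regularElements σ Ω) {f : G σ Ω}
    {φ ψ : SmoothFun Ω} (hψ : ψ ∈ GevreyTest σ Ω)
    (hφψ : ∀ x ∈ tsupport (ψ : Ω → ℂ), ∀ᶠ y in 𝓝 x, (φ : Ω → ℂ) y = 1)
    {ξ₀ : EuclideanSpace ℝ (Fin m)} (h0 : ξ₀ ≠ 0) (h : ξ₀ ∉ singCone (ofSmooth σ φ * f)) :
    ξ₀ ∉ singCone (ofSmooth σ ψ * diffOp N a f) := by
  obtain ⟨Γ, hΓ, H, hH, ⟨L, hL, hHL⟩, hdec⟩ := (notMem_singCone_iff h0).1 h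
  obtain ⟨Γ', hΓ', δ, hδ, hδ', hcone⟩ := hΓ.exists_shrink
  have hm : 0 < m := by
    rcases Nat.eq_zero_or_pos m with rfl | hm
    · exact absurd (Subsingleton.elim _ _) h0
    · exact hm
  choose! A hA hAcl using fun α (hα : ∑ i, α i ≤ N) => ha α hα
  set K := tsupport (ψ : Ω → ℂ) with hK
  have hKc : IsCompact K := hψ.2.isCompact
  have hHc : ∀ ε, HasCompactSupport ((H : Net Ω) ε : Ω → ℂ) := fun ε =>
    hL.of_isClosed_subset (isClosed_tsupport _) (hHL ε)
  set D : (Fin m → ℕ) → Moderate σ Ω := fun α =>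
    ⟨fun ε => mderiv α ((H : Net Ω) ε), IsModerate.mderiv H.2 α⟩ with hD
  set P : Moderate σ Ω := ⟨fun _ => ψ, isModerate_const ψ⟩ with hP
  -- The product is grouped as `(ψ a_α) · ∂^α H`: the first factor is Gevrey regular with support in
  -- `K`, the second decays on `Γ` with support in `L`.
  set T : (Fin m → ℕ) → Moderate σ Ω := fun α =>
    (-Complex.I) ^ (∑ i, α i) • (P * A α * D α) with hT
  have hTdec : ∀ α ∈ multiIndices m N, DecaysOn σ Γ' (T α : Net Ω) := fun α hα => by
    have hα' := mem_multiIndices.1 hα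
    refine DecaysOn.const_smul (f := fun ε => (ψ * (A α : Net Ω) ε) * mderiv α ((H : Net Ω) ε)) ?_ _
    refine DecaysOn.mul (K := K) (L := L) hσ hm hδ hδ' hcone hKc hL
      (fun ε => tsupport_mul_subset_of_left subset_rfl)
      (fun ε => (tsupport_mderiv_subset _ α).trans (hHL ε))
      ((hA α hα').directionalGevreyBound_mul hσ.le hψ.1 hKc) (H.2 α) (hdec.mderiv hσ hHc α)
  have hTsupp : ∀ α ∈ multiIndices m N, ∀ ε, tsupport ((T α : Net Ω) ε : Ω → ℂ) ⊆ K :=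
    fun α _ ε => by
      have : (T α : Net Ω) ε = ψ * ((-Complex.I) ^ (∑ i, α i)
          • ((A α : Net Ω) ε * mderiv α ((H : Net Ω) ε))) := by
        rw [mul_smul_comm, ← mul_assoc]
        rfl
      rw [this]
      exact tsupport_mul_subset_of_left subset_rfl
  have hsum := DecaysOn.sum (multiIndices m N) hKc hTdec hTsupp
  have hcoe : ((∑ α ∈ multiIndices m N, T α : Moderate σ Ω) : Net Ω)
      = ∑ α ∈ multiIndices m N, (T α : Net Ω) := by
    push_cast
    rfl
  rw [← hcoe] at hsum
  refine (notMem_singCone_iff h0).2 ⟨Γ', hΓ', ∑ α ∈ multiIndices m N, T α, ?_,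
    ⟨K, hKc, hsum.2⟩, hsum.1⟩
  rw [cl_sum, diffOp, Finset.mul_sum]
  refine Finset.sum_congr rfl fun α hα => ?_
  -- `H` need not be `φ` times a representative of `f`; only its class enters.
  have hDcl : cl (D α) = gderiv α (ofSmooth σ φ * f) := by
    rw [← hH, gderiv_cl]
  have hPcl : cl P = ofSmooth σ ψ := rfl
  rw [hT]
  dsimp only
  rw [cl_smul, cl_mul, cl_mul, hAcl α (mem_multiIndices.1 hα), hDcl, hPcl, mul_right_comm,
    ofSmooth_mul_gderiv hφψ, mul_smul_comm, mul_smul_comm, mul_right_comm, mul_assoc]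

end GenGevrey

theorem mainTheorem9 {m : ℕ} (Ω : TopologicalSpace.Opens (EuclideanSpace ℝ (Fin m)))
    (σ : ℝ) (hσ : 1 < σ) (N : ℕ) (a : (Fin m → ℕ) → GenGevrey.G σ Ω)
    (ha : ∀ α : Fin m → ℕ, ∑ i, α i ≤ N → a α ∈ GenGevrey.regularElements σ Ω)
    (f : GenGevrey.G σ Ω) :
    GenGevrey.waveFront (GenGevrey.diffOp N a f) ⊆ GenGevrey.waveFront f := by
  rintro ⟨x₀, ξ₀⟩ ⟨h0, h⟩
  refine ⟨h0, fun φ hφ hφ1 => ?_⟩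
  -- If some `φ` makes `ξ₀` nonsingular for `φ f`, its dilate `ψ` makes `ξ₀` nonsingular for `ψ P
  -- f`, contrary to `h`.
  by_contra hsing
  obtain ⟨ψ, hψ, hψ1, hφψ⟩ := GenGevrey.exists_gevreyTest_shrink hφ hφ1
  exact GenGevrey.notMem_singCone_ofSmooth_mul_diffOp (zero_lt_one.trans hσ) ha hψ hφψ h0 hsing
    (h ψ hψ hψ1)
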